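/- Let $\omega$ be a Poisson point field on space-time $\mathbb{R}\times\mathbb{R}$ (points are written $(x,r)$, $x$ space, $r$ time) with Lebesgue intensity measure: its realizations are locally finite point sets, the number $\omega(B)$ of points in a bounded Borel set $B$ is Poisson distributed with mean the area of $B$, and $\omega(B_1),\dots,\omega(B_m)$ are independent for disjoint bounded Borel sets $B_1,\dots,B_m$. For $s<t$ and $x,y\in\mathbb{R}$ let $$A^{s,t}(x,y)=\min_{\gamma(s)=x,\ \gamma(t)=y}\left(\frac12\int_s^t\dot\gamma(r)^2\,dr-\#\{(z,r)\in\omega:\ s\le r<t,\ z=\gamma(r)\}\right),$$ the minimum being taken over absolutely continuous paths $\gamma:[s,t]\to\mathbb{R}$; also put $A^{0,0}(0,0)=0$. Then the following holds. 1. With probability one, the minimum defining $A^{s,t}(x,y)$ is attained and finite for all $s<t$ and all $x,y\in\mathbb{R}$. 2. For every $v\in\mathbb{R}$ there is a constant $C=C(v)>0$ such that for all $t\ge 0$ the random variable $A^{0,t}(0,vt)$ is integrable and $\mathbb{E}|A^{0,t}(0,vt)|\le Ct$. 3. There is a deterministic function $\alpha:\mathbb{R}\to\mathbb{R}$ such that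 for every $v\in\mathbb{R}$ $$\frac{A^{0,t}(0,vt)}{t}\longrightarrow\alpha(v)\qquad\text{as } t\to\infty\ (t\in\mathbb{R}),\ \text{almost surely and in } L^1 .$$ 4. This function satisfies $\alpha(v)=\alpha(0)+\dfrac{v^2}{2}$ for all $v\in\mathbb{R}$, and $\alpha(0)<0$. -/

import Mathlib

open MeasureTheory ProbabilityTheory Filter Topology
open scoped NNReal ENNReal

noncomputable section

/-- Configurations: locally finite subsets of space-time `ℝ × ℝ`. A point is written `(x, r)`,
first the space coordinate, then the time coordinate. -/
def Config : Type :=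
  {S : Set (ℝ × ℝ) // ∀ B : Set (ℝ × ℝ), Bornology.IsBounded B → (S ∩ B).Finite}

/-- The set of points of a configuration. -/
def Config.points (ω : Config) : Set (ℝ × ℝ) := ω.1

/-- `ω.count A` is the number of configuration points in `A` (for bounded `A` this number is
finite, and only bounded `A` are used). -/
def Config.count (ω : Config) (A : Set (ℝ × ℝ)) : ℕ := (ω.points ∩ A).ncard

/-- The σ-algebra on configurations generated by the maps `ω ↦ ω(A)`, with `A` running through
all bounded Borel sets. -/
instance Config.instMeasurableSpace : MeasurableSpace Config :=
  ⨆ (A : Set (ℝ × ℝ)) (_ : MeasurableSet A) (_ : Bornology.IsBounded A),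
    MeasurableSpace.comap (fun ω : Config => ω.count A) ⊤

theorem Config.measurable_count {A : Set (ℝ × ℝ)} (hA : MeasurableSet A)
    (hb : Bornology.IsBounded A) : Measurable (fun ω : Config => ω.count A) := by
  have h : MeasurableSpace.comap (fun ω : Config => ω.count A) ⊤ ≤
      Config.instMeasurableSpace :=
    le_iSup_of_le A (le_iSup_of_le hA (le_iSup_of_le hb le_rfl))
  exact Measurable.of_comap_le h

/-- `P` is the law of the homogeneous Poisson point field on space-time whose intensity measure
is Lebesgue measure. -/
structure IsPoissonField (P : Measure Config) : Prop where
  /-- the number of points in a bounded Borel set is Poisson, with mean the area of the set -/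
  law_count : ∀ A : Set (ℝ × ℝ), MeasurableSet A → Bornology.IsBounded A →
    P.map (fun ω => ω.count A) = poissonMeasure (volume A).toNNReal
  /-- the numbers of points in disjoint bounded Borel sets are independent -/
  indep_count : ∀ (m : ℕ) (A : Fin m → Set (ℝ × ℝ)), (∀ i, MeasurableSet (A i)) →
    (∀ i, Bornology.IsBounded (A i)) → Pairwise (fun i j => Disjoint (A i) (A j)) →
    iIndepFun (fun i (ω : Config) => ω.count (A i)) P

/-- The kinetic action `(1/2) ∫ₛᵗ γ'(r)² dr`. It is used only for absolutely continuous paths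
whose derivative is square integrable on `[s, t]`. -/
def kineticAction (s t : ℝ) (γ : ℝ → ℝ) : ℝ := (1 / 2) * ∫ r in s..t, deriv γ r ^ 2

/-- The number of configuration points visited by the path `γ` during the time interval
`[s, t)`. -/
def visits (ω : Config) (s t : ℝ) (γ : ℝ → ℝ) : ℕ :=
  ω.count ((fun r => (γ r, r)) '' Set.Ico s t)

/-- Paths from `(x, s)` to `(y, t)`: absolutely continuous on `[s, t]`, with finite kinetic
action (all others have action `+∞`). Only the values of `γ` on `[s, t]` matter. -/
structure IsPath (s t x y : ℝ) (γ : ℝ → ℝ) : Prop where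
  absCont : AbsolutelyContinuousOnInterval γ s t
  finiteAction : IntervalIntegrable (fun r => deriv γ r ^ 2) volume s t
  start_eq : γ s = x
  end_eq : γ t = y

/-- The set of the actions of all paths from `(x, s)` to `(y, t)`. -/
def pathActions (ω : Config) (s t x y : ℝ) : Set ℝ :=
  {a | ∃ γ : ℝ → ℝ, IsPath s t x y γ ∧ a = kineticAction s t γ - (visits ω s t γ : ℝ)}

/-- The optimal action `A^{s,t}(x, y)` between the space-time points `(x, s)` and `(y, t)`. -/
def optimalAction (ω : Config) (s t x y : ℝ) : ℝ := sInf (pathActions ω s t x y)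

end

/-! The shear `(x, r) ↦ (x - v r, r)` preserves area, hence the Poisson law, and lowers the kinetic
action of every path from `(0, 0)` to `(v t, t)` by the deterministic amount `v² t / 2`. So velocity
`v` reduces to velocity `0`: almost surely `A^{0,t}(0, v t) = v² t / 2 - Z_t ∘ shear` for all `t ≥
0`, with `Z_t` the largest gain (`maxGain`) of a path from `0` to `0`. Once `Z_t / t → z`, this
gives `α v = v² / 2 - z`, and `z ≥ 𝔼 Z_1 > 0`.

Exponential moments carry both existence and integrability. Cut time into unit slabs. A path
displaced by about `ρ` within a slab pays kinetic action at least `ρ² / 2`, while the points within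
its reach are Poisson with mean linear in `ρ`, so half of the action already beats the exponential
moment of the visits. Independence of the slabs then bounds the expectation of the exponential of
visits minus half the action geometrically in time (`IsPoissonField.lintegral_tsum_partitionBound`).
The other half of the action makes the problem coercive: competitive paths stay in a box, and
replacing a path by the broken line through its visited points never increases the action, so only
finitely many candidates remain (`isLeast_optimalAction`).

For the limit, gluing paths gives `Z_{s+t} ≥ Z_s + Z'_t` with `Z'_t` an independent copy of `Z_t`.
This independence replaces the subadditive ergodic theorem by a variance argument along the times `m
2^n`: for `w_n = (K - Z/t)⁺` the variances are bounded by a telescoping sum of second moments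
(`IsSuperadditiveProcess.ae_tendsto_dyadic`). Monotonicity of `Z` fills in the other times, and `L¹`
convergence follows from convergence of the means. -/

/-! ### Calculus of paths and of their kinetic action. -/

theorem AbsolutelyContinuousOnInterval.congr_of_eqOn {f g : ℝ → ℝ} {a b : ℝ}
    (hf : AbsolutelyContinuousOnInterval f a b) (h : Set.EqOn g f (Set.uIcc a b)) :
    AbsolutelyContinuousOnInterval g a b := by
  rw [absolutelyContinuousOnInterval_iff] at hf ⊢
  intro ε hε
  obtain ⟨δ, hδ, H⟩ := hf ε hε
  refine ⟨δ, hδ, fun E hE hd => ?_⟩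
  convert H E hE hd using 1
  refine Finset.sum_congr rfl fun i hi => ?_
  rw [h (hE.1 i hi).1, h (hE.1 i hi).2]

theorem IsPath.eq_integral {s t x y : ℝ} {γ : ℝ → ℝ} (h : IsPath s t x y γ) {u : ℝ}
    (hu : u ∈ Set.Icc s t) : γ u = x + ∫ v in s..u, deriv γ v := by
  have hst : s ≤ t := hu.1.trans hu.2
  have hac : AbsolutelyContinuousOnInterval γ s u :=
    h.absCont.mono (by rw [Set.uIcc_of_le hu.1, Set.uIcc_of_le hst]; exact Set.Icc_subset_Icc_right hu.2)
  rw [hac.integral_deriv_eq_sub, h.start_eq]; ring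

/-- Lebesgue differentiation at interior times. The time `t` has to be discarded: `deriv` is
two-sided and nothing is assumed about `γ` beyond `t`. -/
theorem deriv_ae_eq_of_eq_integral {s t x : ℝ} {γ g : ℝ → ℝ} (hst : s ≤ t)
    (hg : IntervalIntegrable g volume s t)
    (h : ∀ u ∈ Set.Icc s t, γ u = x + ∫ v in s..u, g v) :
    ∀ᵐ u, u ∈ Set.uIoc s t → deriv γ u = g u := by
  have hne : ∀ᵐ u : ℝ, u ≠ t := by simp [ae_iff, measure_singleton]
  filter_upwards [hg.ae_hasDerivAt_integral, hne] with u hu hut hmem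
  rw [Set.uIoc_of_le hst] at hmem
  have hd := hu (by rw [Set.uIcc_of_le hst]; exact ⟨hmem.1.le, hmem.2⟩) s (by simp)
  have h1 : HasDerivAt (fun w => x + ∫ v in s..w, g v) (g u) u := hd.const_add x
  have hev : γ =ᶠ[𝓝 u] (fun w => x + ∫ v in s..w, g v) := by
    filter_upwards [Ioo_mem_nhds hmem.1 (lt_of_le_of_ne hmem.2 hut)] with w hw
    exact h w ⟨hw.1.le, hw.2.le⟩
  exact (h1.congr_of_eventuallyEq hev).deriv

theorem isPath_of_eq_integral {s t x : ℝ} {γ g : ℝ → ℝ} (hst : s ≤ t)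
    (hg : IntervalIntegrable g volume s t)
    (hg2 : IntervalIntegrable (fun u => g u ^ 2) volume s t)
    (h : ∀ u ∈ Set.Icc s t, γ u = x + ∫ v in s..u, g v) :
    IsPath s t x (γ t) γ := by
  have hae := deriv_ae_eq_of_eq_integral hst hg h
  refine ⟨?_, ?_, ?_, rfl⟩
  · have h1 := hg.absolutelyContinuousOnInterval_intervalIntegral (c := s) (by simp)
    have h2 : AbsolutelyContinuousOnInterval (fun _ : ℝ => x) s t :=
      (LipschitzWith.const x).lipschitzOnWith.absolutelyContinuousOnInterval
    refine (h2.add h1).congr_of_eqOn fun u hu => ?_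
    rw [Set.uIcc_of_le hst] at hu
    simpa using h u hu
  · refine hg2.congr_ae ?_
    rw [Filter.EventuallyEq, ae_restrict_iff' measurableSet_uIoc]
    filter_upwards [hae] with u hu hm
    rw [hu hm]
  · simpa using h s ⟨le_rfl, hst⟩

theorem kineticAction_of_eq_integral {s t x : ℝ} {γ g : ℝ → ℝ} (hst : s ≤ t)
    (hg : IntervalIntegrable g volume s t)
    (h : ∀ u ∈ Set.Icc s t, γ u = x + ∫ v in s..u, g v) :
    kineticAction s t γ = (1 / 2) * ∫ r in s..t, g r ^ 2 := by
  unfold kineticAction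
  rw [intervalIntegral.integral_congr_ae (g := fun r => g r ^ 2)]
  filter_upwards [deriv_ae_eq_of_eq_integral hst hg h] with u hu hm
  rw [hu hm]

theorem IsPath.kineticAction_congr {s t x y : ℝ} {γ γ' : ℝ → ℝ} (hst : s ≤ t)
    (h : IsPath s t x y γ) (he : ∀ u ∈ Set.Icc s t, γ' u = γ u) :
    kineticAction s t γ' = kineticAction s t γ :=
  kineticAction_of_eq_integral hst h.absCont.intervalIntegrable_deriv
    (fun u hu => (he u hu).trans (h.eq_integral hu))

theorem IsPath.mono {s t x y a b : ℝ} {γ : ℝ → ℝ} (h : IsPath s t x y γ) (hsa : s ≤ a)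
    (hab : a ≤ b) (hbt : b ≤ t) : IsPath a b (γ a) (γ b) γ := by
  have hsub : Set.uIcc a b ⊆ Set.uIcc s t := by
    rw [Set.uIcc_of_le hab, Set.uIcc_of_le (hsa.trans (hab.trans hbt))]
    exact Set.Icc_subset_Icc hsa hbt
  exact ⟨h.absCont.mono hsub, h.finiteAction.mono_set hsub, rfl, rfl⟩

theorem IsPath.kineticAction_add {s t x y r : ℝ} {γ : ℝ → ℝ} (h : IsPath s t x y γ) (hsr : s ≤ r)
    (hrt : r ≤ t) : kineticAction s t γ = kineticAction s r γ + kineticAction r t γ := by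
  unfold kineticAction
  rw [← mul_add, intervalIntegral.integral_add_adjacent_intervals
    (h.mono le_rfl hsr hrt).finiteAction (h.mono hsr hrt le_rfl).finiteAction]

theorem kineticAction_nonneg {s t : ℝ} (hst : s ≤ t) (γ : ℝ → ℝ) : 0 ≤ kineticAction s t γ :=
  mul_nonneg (by norm_num) (intervalIntegral.integral_nonneg hst fun _ _ => sq_nonneg _)

/-- Integrate `(γ' - c)² ≥ 0`. The mean velocity as `c` gives the optimality of straight segments.
-/
theorem IsPath.sub_mul_le_kineticAction {s t x y : ℝ} {γ : ℝ → ℝ} (h : IsPath s t x y γ)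
    (hst : s ≤ t) (c : ℝ) : c * (y - x) - c ^ 2 / 2 * (t - s) ≤ kineticAction s t γ := by
  have h1 := h.absCont.intervalIntegrable_deriv
  have h2 := h.finiteAction
  have h3 : 0 ≤ ∫ r in s..t, (deriv γ r - c) ^ 2 :=
    intervalIntegral.integral_nonneg hst fun _ _ => sq_nonneg _
  have h4 : ∫ r in s..t, (deriv γ r - c) ^ 2 =
      (∫ r in s..t, deriv γ r ^ 2) - 2 * c * (∫ r in s..t, deriv γ r) + c ^ 2 * (t - s) := by
    have : (fun r => (deriv γ r - c) ^ 2) =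
        fun r => (deriv γ r ^ 2 - 2 * c * deriv γ r) + c ^ 2 := by ext r; ring
    rw [this, intervalIntegral.integral_add (h2.sub (h1.const_mul _)) (by simp),
      intervalIntegral.integral_sub h2 (h1.const_mul _), intervalIntegral.integral_const_mul]
    simp [mul_comm]
  rw [h4, h.absCont.integral_deriv_eq_sub, h.start_eq, h.end_eq] at h3
  unfold kineticAction
  linarith

theorem IsPath.sq_div_le_kineticAction {s t x y : ℝ} {γ : ℝ → ℝ} (h : IsPath s t x y γ)
    (hst : s < t) : (y - x) ^ 2 / (2 * (t - s)) ≤ kineticAction s t γ := by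
  have := h.sub_mul_le_kineticAction hst.le ((y - x) / (t - s))
  have hpos : 0 < t - s := sub_pos.2 hst
  convert this using 1
  field_simp
  ring

theorem IsPath.sq_le_kineticAction {s t x y r : ℝ} {γ : ℝ → ℝ} (h : IsPath s t x y γ)
    (hr : r ∈ Set.Icc s t) : (γ r - x) ^ 2 ≤ 2 * (t - s) * kineticAction s t γ := by
  have hst := hr.1.trans hr.2
  have hk := h.kineticAction_add hr.1 hr.2
  have h0 := kineticAction_nonneg hr.2 γ
  have h1 := kineticAction_nonneg hr.1 γ
  rcases hr.1.eq_or_lt with he | hlt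
  · rw [← he, h.start_eq, sub_self]
    have := mul_nonneg (sub_nonneg.2 hst) (kineticAction_nonneg hst γ)
    linarith
  · have h2 := (h.mono le_rfl hr.1 hr.2).sq_div_le_kineticAction hlt
    have hpos : 0 < 2 * (r - s) := by linarith
    rw [div_le_iff₀ hpos, h.start_eq] at h2
    have := sub_nonneg.2 hr.2
    nlinarith

/-- The glued path is the integral of the concatenated derivatives, so nothing has to be
differentiated at the junction. -/
theorem IsPath.glue {s r t x y z : ℝ} {γ₁ γ₂ : ℝ → ℝ} (hsr : s ≤ r) (hrt : r ≤ t)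
    (h₁ : IsPath s r x y γ₁) (h₂ : IsPath r t y z γ₂) :
    ∃ γ, IsPath s t x z γ ∧ (∀ u ∈ Set.Icc s r, γ u = γ₁ u) ∧ ∀ u ∈ Set.Icc r t, γ u = γ₂ u := by
  classical
  let γ : ℝ → ℝ := fun u => if u ≤ r then γ₁ u else γ₂ u
  let g : ℝ → ℝ := fun u => if u ≤ r then deriv γ₁ u else deriv γ₂ u
  have e₁ : ∀ u ∈ Set.Icc s r, γ u = γ₁ u := fun u hu => if_pos hu.2
  have e₂ : ∀ u ∈ Set.Icc r t, γ u = γ₂ u := by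
    intro u hu
    rcases hu.1.eq_or_lt with he | hlt
    · rw [← he, h₂.start_eq, e₁ r ⟨hsr, le_rfl⟩, h₁.end_eq]
    · exact if_neg (not_le.2 hlt)
  have gi₁ : ∀ u ∈ Set.uIoc s r, deriv γ₁ u = g u := fun u hu => by
    rw [Set.uIoc_of_le hsr] at hu; exact (if_pos hu.2).symm
  have gi₂ : ∀ u ∈ Set.uIoc r t, deriv γ₂ u = g u := fun u hu => by
    rw [Set.uIoc_of_le hrt] at hu; exact (if_neg (not_le.2 hu.1)).symm
  have i₁ : IntervalIntegrable g volume s r := h₁.absCont.intervalIntegrable_deriv.congr gi₁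
  have i₂ : IntervalIntegrable g volume r t := h₂.absCont.intervalIntegrable_deriv.congr gi₂
  have q₁ : IntervalIntegrable (fun u => g u ^ 2) volume s r :=
    h₁.finiteAction.congr fun u hu => by rw [gi₁ u hu]
  have q₂ : IntervalIntegrable (fun u => g u ^ 2) volume r t :=
    h₂.finiteAction.congr fun u hu => by rw [gi₂ u hu]
  have f₁ : ∀ u ∈ Set.Icc s r, ∫ v in s..u, g v = ∫ v in s..u, deriv γ₁ v := by
    intro u hu
    refine intervalIntegral.integral_congr_ae (.of_forall fun v hv => (gi₁ v ?_).symm)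
    rw [Set.uIoc_of_le hu.1] at hv
    rw [Set.uIoc_of_le hsr]; exact ⟨hv.1, hv.2.trans hu.2⟩
  have f₂ : ∀ u ∈ Set.Icc r t, ∫ v in r..u, g v = ∫ v in r..u, deriv γ₂ v := by
    intro u hu
    refine intervalIntegral.integral_congr_ae (.of_forall fun v hv => (gi₂ v ?_).symm)
    rw [Set.uIoc_of_le hu.1] at hv
    rw [Set.uIoc_of_le hrt]; exact ⟨hv.1, hv.2.trans hu.2⟩
  have hp := isPath_of_eq_integral (x := x) (γ := γ) (hsr.trans hrt) (i₁.trans i₂) (q₁.trans q₂) (by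
    intro u hu
    rcases le_total u r with hur | hru
    · rw [e₁ u ⟨hu.1, hur⟩, f₁ u ⟨hu.1, hur⟩, h₁.eq_integral ⟨hu.1, hur⟩]
    · have hb : IntervalIntegrable g volume r u := i₂.mono_set (by
        rw [Set.uIcc_of_le hru, Set.uIcc_of_le hrt]; exact Set.Icc_subset_Icc_right hu.2)
      rw [e₂ u ⟨hru, hu.2⟩, ← intervalIntegral.integral_add_adjacent_intervals i₁ hb,
        f₁ r ⟨hsr, le_rfl⟩, f₂ u ⟨hru, hu.2⟩, ← add_assoc, ← h₁.eq_integral ⟨hsr, le_rfl⟩,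
        h₁.end_eq, h₂.eq_integral ⟨hru, hu.2⟩])
  rw [e₂ t ⟨hrt, le_rfl⟩, h₂.end_eq] at hp
  exact ⟨γ, hp, e₁, e₂⟩

theorem isPath_affine {s t : ℝ} (hst : s ≤ t) (x c : ℝ) :
    IsPath s t x (x + c * (t - s)) (fun u => x + c * (u - s)) ∧
      kineticAction s t (fun u => x + c * (u - s)) = c ^ 2 / 2 * (t - s) := by
  have h : ∀ u ∈ Set.Icc s t, (fun u => x + c * (u - s)) u = x + ∫ _v in s..u, c := by
    intro u _; simp [mul_comm]
  refine ⟨isPath_of_eq_integral hst (by simp) (by simp) h, ?_⟩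
  rw [kineticAction_of_eq_integral hst (by simp) h]
  simp; ring

theorem exists_isPath_kineticAction_eq {s t : ℝ} (hst : s < t) (x y : ℝ) :
    ∃ γ, IsPath s t x y γ ∧ kineticAction s t γ = (y - x) ^ 2 / (2 * (t - s)) := by
  have hpos : 0 < t - s := sub_pos.2 hst
  obtain ⟨h1, h2⟩ := isPath_affine hst.le x ((y - x) / (t - s))
  refine ⟨_, ?_, h2.trans ?_⟩
  · convert h1 using 1; field_simp; ring
  · field_simp

theorem IsPath.comp_add {s t x y : ℝ} {γ : ℝ → ℝ} (hst : s ≤ t) (h : IsPath s t x y γ) (a : ℝ) :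
    IsPath (s - a) (t - a) x y (fun u => γ (u + a)) ∧
      kineticAction (s - a) (t - a) (fun u => γ (u + a)) = kineticAction s t γ := by
  have i1 := h.absCont.intervalIntegrable_deriv.comp_add_right a
  have i2 := h.finiteAction.comp_add_right a
  have he : ∀ u ∈ Set.Icc (s - a) (t - a),
      (fun u => γ (u + a)) u = x + ∫ v in (s - a)..u, deriv γ (v + a) := by
    intro u hu
    rw [intervalIntegral.integral_comp_add_right]
    simp only [sub_add_cancel]
    exact h.eq_integral ⟨by linarith [hu.1], by linarith [hu.2]⟩
  have hst' : s - a ≤ t - a := by linarith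
  have hp := isPath_of_eq_integral hst' i1 i2 he
  simp only [sub_add_cancel, h.end_eq] at hp
  refine ⟨hp, ?_⟩
  rw [kineticAction_of_eq_integral hst' i1 he,
    intervalIntegral.integral_comp_add_right (fun v => deriv γ v ^ 2)]
  simp [kineticAction]

theorem IsPath.add_linear {s t x y : ℝ} {γ : ℝ → ℝ} (hst : s ≤ t) (h : IsPath s t x y γ) (v : ℝ) :
    IsPath s t (x + v * s) (y + v * t) (fun u => γ u + v * u) ∧
      kineticAction s t (fun u => γ u + v * u) =
        kineticAction s t γ + v * (y - x) + v ^ 2 / 2 * (t - s) := by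
  have j1 := h.absCont.intervalIntegrable_deriv
  have j2 := h.finiteAction
  have i1 : IntervalIntegrable (fun u => deriv γ u + v) volume s t := j1.add (by simp)
  have e2 : (fun u => (deriv γ u + v) ^ 2) =
      fun u => (deriv γ u ^ 2 + 2 * v * deriv γ u) + v ^ 2 := by ext u; ring
  have i2 : IntervalIntegrable (fun u => (deriv γ u + v) ^ 2) volume s t := by
    rw [e2]; exact (j2.add (j1.const_mul _)).add (by simp)
  have he : ∀ u ∈ Set.Icc s t,
      (fun u => γ u + v * u) u = (x + v * s) + ∫ w in s..u, (deriv γ w + v) := by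
    intro u hu
    have : IntervalIntegrable (deriv γ) volume s u := j1.mono_set (by
      rw [Set.uIcc_of_le hu.1, Set.uIcc_of_le hst]; exact Set.Icc_subset_Icc_right hu.2)
    rw [intervalIntegral.integral_add this (by simp)]
    simp only [h.eq_integral hu, intervalIntegral.integral_const, smul_eq_mul]
    ring
  have hp := isPath_of_eq_integral hst i1 i2 he
  simp only [h.end_eq] at hp
  refine ⟨hp, ?_⟩
  rw [kineticAction_of_eq_integral hst i1 he, e2,
    intervalIntegral.integral_add (j2.add (j1.const_mul _)) (by simp),
    intervalIntegral.integral_add j2 (j1.const_mul _), intervalIntegral.integral_const_mul,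
    h.absCont.integral_deriv_eq_sub, h.start_eq, h.end_eq]
  simp [kineticAction]
  ring

theorem IsPath.continuousOn {s t x y : ℝ} {γ : ℝ → ℝ} (hst : s ≤ t) (h : IsPath s t x y γ) :
    ContinuousOn γ (Set.Icc s t) := by
  simpa [Set.uIcc_of_le hst] using h.absCont.continuousOn

/-! ### Counting the points visited by a path. -/

theorem Config.finite_inter_graph (ω : Config) {s t : ℝ} {γ : ℝ → ℝ}
    (h : ContinuousOn γ (Set.Icc s t)) :
    (ω.points ∩ (fun r => (γ r, r)) '' Set.Ico s t).Finite := by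
  refine (ω.2 ((fun r => (γ r, r)) '' Set.Icc s t) ?_).subset
    (Set.inter_subset_inter_right _ (Set.image_mono Set.Ico_subset_Icc_self))
  exact (isCompact_Icc.image_of_continuousOn (h.prodMk continuousOn_id)).isBounded

/-- Exact additivity rests on the half-open time interval: a point at time `r` belongs to the second
piece only. -/
theorem visits_add (ω : Config) {s r t : ℝ} {γ : ℝ → ℝ} (hsr : s ≤ r) (hrt : r ≤ t)
    (h : ContinuousOn γ (Set.Icc s t)) :
    visits ω s t γ = visits ω s r γ + visits ω r t γ := by
  unfold visits Config.count
  rw [← Set.Ico_union_Ico_eq_Ico hsr hrt, Set.image_union, Set.inter_union_distrib_left]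
  refine Set.ncard_union_eq ?_ (ω.finite_inter_graph (h.mono (Set.Icc_subset_Icc_right hrt)))
    (ω.finite_inter_graph (h.mono (Set.Icc_subset_Icc_left hsr)))
  rw [Set.disjoint_left]
  rintro _ ⟨-, u, hu, rfl⟩ ⟨-, w, hw, he⟩
  have : w = u := congrArg Prod.snd he
  exact absurd hu.2 (not_lt.2 (this ▸ hw.1))

theorem visits_congr {ω ω' : Config} {s t : ℝ} {γ γ' : ℝ → ℝ}
    (h : ∀ u ∈ Set.Ico s t, γ' u = γ u)
    (h' : ∀ p : ℝ × ℝ, p.2 ∈ Set.Ico s t → (p ∈ ω'.points ↔ p ∈ ω.points)) :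
    visits ω' s t γ' = visits ω s t γ := by
  unfold visits Config.count
  congr 1
  ext p
  constructor
  · rintro ⟨hp, u, hu, rfl⟩
    refine ⟨(h' _ hu).1 hp, u, hu, ?_⟩
    simp [h u hu]
  · rintro ⟨hp, u, hu, rfl⟩
    refine ⟨(h' _ hu).2 hp, u, hu, ?_⟩
    simp [h u hu]

theorem visits_comp_equiv {ω ω' : Config} {s t s' t' : ℝ} {γ γ' : ℝ → ℝ}
    (e : (ℝ × ℝ) ≃ (ℝ × ℝ)) (h : ∀ p, p ∈ ω.points ↔ e p ∈ ω'.points)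
    (hg : e '' ((fun r => (γ r, r)) '' Set.Ico s t) = (fun r => (γ' r, r)) '' Set.Ico s' t') :
    visits ω' s' t' γ' = visits ω s t γ := by
  unfold visits Config.count
  rw [← hg, ← Set.ncard_image_of_injective (ω.points ∩ _) e.injective]
  congr 1
  ext p
  constructor
  · rintro ⟨hp, q, hq, rfl⟩
    exact ⟨q, ⟨(h q).2 hp, hq⟩, rfl⟩
  · rintro ⟨q, ⟨hp, hq⟩, rfl⟩
    exact ⟨(h q).1 hp, q, hq, rfl⟩

theorem visits_le_count {ω : Config} {s t : ℝ} {γ : ℝ → ℝ} {B : Set (ℝ × ℝ)}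
    (hB : Bornology.IsBounded B) (h : ∀ u ∈ Set.Ico s t, (γ u, u) ∈ B) :
    visits ω s t γ ≤ ω.count B := by
  refine Set.ncard_le_ncard (Set.inter_subset_inter_right _ ?_) (ω.2 B hB)
  rintro _ ⟨u, hu, rfl⟩
  exact h u hu

/-! ### Reduction to broken lines and existence of minimizers. -/

/-- Kinetic action of the straight segment between two space-time points. -/
noncomputable def segmentCost (p q : ℝ × ℝ) : ℝ := (q.1 - p.1) ^ 2 / (2 * (q.2 - p.2))

/-- Kinetic action of the broken line from `p` through the points of a list to `q`. -/
noncomputable def chainEnergy (q : ℝ × ℝ) : ℝ × ℝ → List (ℝ × ℝ) → ℝ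
  | p, [] => segmentCost p q
  | p, a :: l => segmentCost p a + chainEnergy q a l

/-- The times along `p`, the points of the list, `q` are strictly increasing. -/
def TimeOrdered (q : ℝ × ℝ) : ℝ × ℝ → List (ℝ × ℝ) → Prop
  | p, [] => p.2 < q.2
  | p, a :: l => p.2 < a.2 ∧ TimeOrdered q a l

open Classical in
/-- `1` if `p` is a configuration point and `0` otherwise. -/
noncomputable def Config.indicatorAt (ω : Config) (p : ℝ × ℝ) : ℕ := if p ∈ ω.points then 1 else 0

theorem TimeOrdered.lt {q : ℝ × ℝ} {l : List (ℝ × ℝ)} : ∀ {p : ℝ × ℝ}, TimeOrdered q p l →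
    p.2 < q.2 := by
  induction l with
  | nil => exact fun h => h
  | cons a l ih => exact fun h => h.1.trans (ih h.2)

theorem TimeOrdered.lt_of_mem {q : ℝ × ℝ} {l : List (ℝ × ℝ)} : ∀ {p : ℝ × ℝ}, TimeOrdered q p l →
    ∀ a ∈ l, p.2 < a.2 := by
  induction l with
  | nil => simp
  | cons b l ih =>
    intro p h a ha
    rcases List.mem_cons.1 ha with rfl | ha
    · exact h.1
    · exact h.1.trans (ih h.2 a ha)

theorem TimeOrdered.nodup {q : ℝ × ℝ} {l : List (ℝ × ℝ)} : ∀ {p : ℝ × ℝ}, TimeOrdered q p l →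
    l.Nodup := by
  induction l with
  | nil => simp
  | cons b l ih =>
    intro p h
    exact List.nodup_cons.2 ⟨fun hb => lt_irrefl _ (h.2.lt_of_mem b hb), ih h.2⟩

/-- Between consecutive times of `T` a straight segment is cheapest; the induction splits off the
earliest time. -/
theorem IsPath.exists_chain_of_times {t y : ℝ} {γ : ℝ → ℝ} (T : Finset ℝ) :
    ∀ {s x : ℝ}, s < t → IsPath s t x y γ → (∀ u ∈ T, u ∈ Set.Ioo s t) →
    ∃ l : List (ℝ × ℝ), TimeOrdered (y, t) (x, s) l ∧ l.length = T.card ∧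
      (∀ p ∈ l, ∃ u ∈ T, p = (γ u, u)) ∧ chainEnergy (y, t) (x, s) l ≤ kineticAction s t γ := by
  induction T using Finset.induction_on_min with
  | empty =>
    intro s x hst h _
    exact ⟨[], hst, rfl, by simp, h.sq_div_le_kineticAction hst⟩
  | insert a T ha ih =>
    intro s x hst h hT
    have has := hT a (Finset.mem_insert_self _ _)
    have h1 := h.mono le_rfl has.1.le has.2.le
    have h2 := h.mono has.1.le has.2.le le_rfl
    rw [h.start_eq] at h1
    rw [h.end_eq] at h2
    obtain ⟨l, hl, hlen, hmem, hE⟩ := ih has.2 h2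
      (fun u hu => ⟨ha u hu, (hT u (Finset.mem_insert_of_mem hu)).2⟩)
    refine ⟨(γ a, a) :: l, ⟨has.1, hl⟩, ?_, ?_, ?_⟩
    · rw [List.length_cons, hlen, Finset.card_insert_of_notMem fun h => lt_irrefl _ (ha a h)]
    · intro p hp
      rcases List.mem_cons.1 hp with rfl | hp
      · exact ⟨a, Finset.mem_insert_self _ _, rfl⟩
      · obtain ⟨u, hu, rfl⟩ := hmem p hp
        exact ⟨u, Finset.mem_insert_of_mem hu, rfl⟩
    · rw [h.kineticAction_add has.1.le has.2.le]
      exact add_le_add (h1.sq_div_le_kineticAction has.1) hE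

theorem IsPath.exists_chain (ω : Config) {s t x y : ℝ} {γ : ℝ → ℝ} (hst : s < t)
    (h : IsPath s t x y γ) :
    ∃ l : List (ℝ × ℝ), TimeOrdered (y, t) (x, s) l ∧
      (∀ p ∈ l, p ∈ ω.points ∧ ∃ u ∈ Set.Ioo s t, p = (γ u, u)) ∧
      chainEnergy (y, t) (x, s) l ≤ kineticAction s t γ ∧
      visits ω s t γ ≤ l.length + ω.indicatorAt (x, s) := by
  classical
  have hfin := ω.finite_inter_graph (h.continuousOn hst.le)
  set S := ω.points ∩ (fun r => (γ r, r)) '' Set.Ico s t with hS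
  set T₀ := hfin.toFinset.image Prod.snd with hT₀
  have hT₀mem : ∀ u ∈ T₀, u ∈ Set.Ico s t ∧ (γ u, u) ∈ ω.points := by
    intro u hu
    obtain ⟨p, hp, rfl⟩ := Finset.mem_image.1 hu
    obtain ⟨hpω, w, hw, rfl⟩ := hfin.mem_toFinset.1 hp
    exact ⟨hw, hpω⟩
  have hcard : visits ω s t γ = T₀.card := by
    rw [hT₀, Finset.card_image_of_injOn, ← Set.ncard_eq_toFinset_card _ hfin]
    · rfl
    · intro p hp q hq hpq
      obtain ⟨-, u, -, rfl⟩ := hfin.mem_toFinset.1 hp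
      obtain ⟨-, w, -, rfl⟩ := hfin.mem_toFinset.1 hq
      have : u = w := hpq
      rw [this]
  -- A visit at the initial time `s` is to the starting point itself; it cannot be a vertex and is
  -- counted by `indicatorAt` instead.
  obtain ⟨l, hl, hlen, hmem, hE⟩ := h.exists_chain_of_times (T₀.erase s) hst (fun u hu => by
    have h1 := Finset.mem_erase.1 hu
    have h2 := (hT₀mem u h1.2).1
    exact ⟨lt_of_le_of_ne h2.1 (Ne.symm h1.1), h2.2⟩)
  refine ⟨l, hl, ?_, hE, ?_⟩
  · intro p hp
    obtain ⟨u, hu, rfl⟩ := hmem p hp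
    have h1 := Finset.mem_erase.1 hu
    have h2 := hT₀mem u h1.2
    exact ⟨h2.2, u, ⟨lt_of_le_of_ne h2.1.1 (Ne.symm h1.1), h2.1.2⟩, rfl⟩
  · rw [hcard, hlen]
    by_cases hs : s ∈ T₀
    · have := (hT₀mem s hs).2
      rw [h.start_eq] at this
      rw [Config.indicatorAt, if_pos this, Finset.card_erase_add_one hs]
    · rw [Finset.erase_eq_of_notMem hs]; omega

theorem IsPath.indicatorAt_le_visits (ω : Config) {s t x y : ℝ} {γ : ℝ → ℝ} (hst : s < t)
    (h : IsPath s t x y γ) : ω.indicatorAt (x, s) ≤ visits ω s t γ := by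
  unfold Config.indicatorAt
  split_ifs with hx
  · refine (Set.ncard_pos (ω.finite_inter_graph (h.continuousOn hst.le))).2 ⟨(x, s), hx, s, ?_, ?_⟩
    · exact ⟨le_rfl, hst⟩
    · simp [h.start_eq]
  · exact Nat.zero_le _

/-- Converse to `IsPath.exists_chain`. Only an inequality holds for the visits, since segments may
run through further points, which only lowers the action. -/
theorem exists_isPath_of_timeOrdered (ω : Config) {t y : ℝ} (l : List (ℝ × ℝ)) :
    ∀ {p : ℝ × ℝ}, TimeOrdered (y, t) p l → (∀ a ∈ l, a ∈ ω.points) →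
    ∃ γ, IsPath p.2 t p.1 y γ ∧ kineticAction p.2 t γ = chainEnergy (y, t) p l ∧
      l.length + ω.indicatorAt p ≤ visits ω p.2 t γ := by
  induction l with
  | nil =>
    intro p h _
    obtain ⟨γ, hγ, hk⟩ := exists_isPath_kineticAction_eq h p.1 y
    refine ⟨γ, hγ, hk, ?_⟩
    simpa using hγ.indicatorAt_le_visits ω h
  | cons a l ih =>
    intro p h hl
    obtain ⟨γ₂, h₂, hk₂, hv₂⟩ := ih h.2 fun b hb => hl b (List.mem_cons_of_mem _ hb)
    obtain ⟨γ₁, h₁, hk₁⟩ := exists_isPath_kineticAction_eq h.1 p.1 a.1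
    obtain ⟨γ, hγ, e₁, e₂⟩ := h₁.glue h.1.le h.2.lt.le h₂
    have hat : a.2 ≤ t := h.2.lt.le
    refine ⟨γ, hγ, ?_, ?_⟩
    · rw [hγ.kineticAction_add h.1.le hat, h₁.kineticAction_congr h.1.le e₁,
        h₂.kineticAction_congr hat e₂, hk₁, hk₂]
      rfl
    · rw [visits_add ω h.1.le hat (hγ.continuousOn (h.1.le.trans hat)),
        visits_congr (ω := ω) (ω' := ω) (fun u hu => e₁ u ⟨hu.1, hu.2.le⟩) (fun _ _ => Iff.rfl),
        visits_congr (ω := ω) (ω' := ω) (fun u hu => e₂ u ⟨hu.1, hu.2.le⟩) (fun _ _ => Iff.rfl)]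
      have h3 := h₁.indicatorAt_le_visits ω h.1
      have h4 : ω.indicatorAt a = 1 := if_pos (hl a List.mem_cons_self)
      rw [List.length_cons]
      change _ + ω.indicatorAt (p.1, p.2) ≤ visits ω p.2 a.2 γ₁ + visits ω a.2 t γ₂
      omega

/-- Strictly increasing times forbid repetition, so the length is at most the cardinality of `F`. -/
theorem finite_timeOrdered {F : Set (ℝ × ℝ)} (hF : F.Finite) (p q : ℝ × ℝ) :
    {l : List (ℝ × ℝ) | TimeOrdered q p l ∧ ∀ a ∈ l, a ∈ F}.Finite := by
  have := hF.to_subtype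
  refine ((List.finite_length_le F (Nat.card F)).image (List.map Subtype.val)).subset ?_
  rintro l ⟨hl, hmem⟩
  lift l to List F using hmem
  have hn : l.Nodup := hl.nodup.of_map _
  have := Fintype.ofFinite F
  refine ⟨l, ?_, rfl⟩
  simpa [Nat.card_eq_fintype_card] using hn.length_le_card

/-- Coercivity: a path with action at most `M`, the cost of the straight segment, satisfies `kin / 2
≤ M + C`, so it stays within distance `R` of `x`. Its broken line has vertices among the finitely
many points of the box `B`, which leaves a finite minimization. -/
theorem isLeast_optimalAction {ω : Config} {s t x y C : ℝ} (hst : s < t)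
    (hC : ∀ γ, IsPath s t x y γ → (visits ω s t γ : ℝ) - kineticAction s t γ / 2 ≤ C) :
    IsLeast (pathActions ω s t x y) (optimalAction ω s t x y) := by
  set M := (y - x) ^ 2 / (2 * (t - s)) with hM
  set R := Real.sqrt (2 * (t - s) * (2 * (M + C))) with hR
  set B : Set (ℝ × ℝ) := Set.Icc (x - R) (x + R) ×ˢ Set.Icc s t
  have hB : Bornology.IsBounded B := (Metric.isBounded_Icc _ _).prod (Metric.isBounded_Icc _ _)
  set φ : List (ℝ × ℝ) → ℝ := fun l =>
    chainEnergy (y, t) (x, s) l - (l.length + ω.indicatorAt (x, s) : ℕ)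
  obtain ⟨l₀, hl₀, hmin⟩ := Set.exists_min_image _ φ
    (finite_timeOrdered (ω.2 B hB) (x, s) (y, t)) ⟨[], hst, by simp⟩
  obtain ⟨γ₀, hγ₀, hk₀, hv₀⟩ := exists_isPath_of_timeOrdered ω l₀ hl₀.1 fun a ha => (hl₀.2 a ha).1
  have h₀ : kineticAction s t γ₀ - visits ω s t γ₀ ≤ φ l₀ := by
    have : ((l₀.length + ω.indicatorAt (x, s) : ℕ) : ℝ) ≤ visits ω s t γ₀ := by exact_mod_cast hv₀
    simp only [φ]
    simp only at hk₀
    linarith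
  have hleast : IsLeast (pathActions ω s t x y) (kineticAction s t γ₀ - visits ω s t γ₀) := by
    refine ⟨⟨γ₀, hγ₀, rfl⟩, ?_⟩
    rintro _ ⟨γ, hγ, rfl⟩
    refine h₀.trans ?_
    rcases le_total (kineticAction s t γ - visits ω s t γ) M with hle | hge
    · have hkin : kineticAction s t γ ≤ 2 * (M + C) := by linarith [hC γ hγ]
      obtain ⟨l, hl, hmem, hE, hv⟩ := hγ.exists_chain ω hst
      refine (hmin l ⟨hl, fun a ha => ?_⟩).trans ?_
      · obtain ⟨haω, u, hu, rfl⟩ := hmem a ha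
        refine ⟨haω, ?_, hu.1.le, hu.2.le⟩
        have h1 := hγ.sq_le_kineticAction ⟨hu.1.le, hu.2.le⟩
        have h2 : (γ u - x) ^ 2 ≤ 2 * (t - s) * (2 * (M + C)) :=
          h1.trans (mul_le_mul_of_nonneg_left hkin (by linarith))
        have h3 := abs_le.1 (Real.abs_le_sqrt h2)
        exact ⟨by linarith [h3.1], by linarith [h3.2]⟩
      · have : (visits ω s t γ : ℝ) ≤ (l.length + ω.indicatorAt (x, s) : ℕ) := by exact_mod_cast hv
        simp only [φ]
        linarith
    -- A path with action at least `M` loses to the straight segment, the empty list of vertices.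
    · refine (hmin [] ⟨hst, by simp⟩).trans (le_trans ?_ hge)
      have : (0 : ℝ) ≤ (([] : List (ℝ × ℝ)).length + ω.indicatorAt (x, s) : ℕ) := Nat.cast_nonneg _
      have h1 : chainEnergy (y, t) (x, s) [] = M := rfl
      simp only [φ]
      linarith
  rw [optimalAction, hleast.csInf_eq]
  exact hleast

/-! ### Measurability of the maximal gain. -/

/-- The largest value of visits minus kinetic action among paths from `(0, s)` to `(0, t)`. -/
noncomputable def maxGain (s t : ℝ) (ω : Config) : ℝ≥0∞ :=
  ⨆ (γ : ℝ → ℝ) (_ : IsPath s t 0 0 γ), ENNReal.ofReal (visits ω s t γ - kineticAction s t γ)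

open Classical in
/-- The gain of a broken line from `(0, s)` to `(0, t)` with given vertices; `k` is added to the
number of vertices. -/
noncomputable def chainGain (s t : ℝ) (k : ℕ) (l : List (ℝ × ℝ)) : ℝ≥0∞ :=
  if TimeOrdered (0, t) (0, s) l then
    ENNReal.ofReal ((l.length + k : ℕ) - chainEnergy (0, t) (0, s) l) else 0

theorem maxGain_eq_iSup_chainGain {s t : ℝ} (hst : s < t) (ω : Config) :
    maxGain s t ω = ⨆ (l : List (ℝ × ℝ)) (_ : ∀ p ∈ l, p ∈ ω.points),
      chainGain s t (ω.indicatorAt (0, s)) l := by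
  apply le_antisymm
  · refine iSup₂_le fun γ hγ => ?_
    obtain ⟨l, hl, hmem, hE, hv⟩ := hγ.exists_chain ω hst
    refine le_iSup₂_of_le l (fun p hp => (hmem p hp).1) ?_
    rw [chainGain, if_pos hl]
    refine ENNReal.ofReal_le_ofReal (sub_le_sub ?_ hE)
    exact_mod_cast hv
  · refine iSup₂_le fun l hmem => ?_
    unfold chainGain
    split_ifs with hl
    · obtain ⟨γ, hγ, hk, hv⟩ := exists_isPath_of_timeOrdered ω l hl hmem
      refine le_iSup₂_of_le γ hγ (ENNReal.ofReal_le_ofReal (sub_le_sub ?_ hk.le))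
      exact_mod_cast hv
    · exact zero_le

theorem continuousAt_segmentCost {p q : ℝ × ℝ} (h : p.2 < q.2) :
    ContinuousAt (fun z : (ℝ × ℝ) × (ℝ × ℝ) => segmentCost z.1 z.2) (p, q) := by
  unfold segmentCost
  refine ContinuousAt.div (by fun_prop) (by fun_prop) ?_
  simp only
  linarith

/-- Time ordering and a strict energy bound are open conditions on the vertices. The starting point
also varies in a neighbourhood `U`, so that in the induction the box of the first vertex can be
taken inside the `U` of the remaining chain. -/
theorem TimeOrdered.exists_boxes {q : ℝ × ℝ} (l : List (ℝ × ℝ)) : ∀ {p : ℝ × ℝ} {e : ℝ},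
    TimeOrdered q p l → chainEnergy q p l < e →
    ∃ U ∈ 𝓝 p, ∃ L : List (TopologicalSpace.countableBasis (ℝ × ℝ)),
      List.Forall₂ (fun a B => a ∈ B.1) l L ∧
      ∀ p' ∈ U, ∀ l', List.Forall₂ (fun a B => a ∈ B.1) l' L →
        TimeOrdered q p' l' ∧ chainEnergy q p' l' < e := by
  induction l with
  | nil =>
    intro p e h he
    have h1 : ∀ᶠ p' in 𝓝 p, p'.2 < q.2 := (continuous_snd.tendsto p).eventually_lt_const h
    have h2 : ContinuousAt (fun p' => segmentCost p' q) p :=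
      (continuousAt_segmentCost h).comp (f := fun p' => (p', q)) (by fun_prop)
    have h3 : ∀ᶠ p' in 𝓝 p, segmentCost p' q < e := h2.eventually_lt_const he
    refine ⟨_, h1.and h3, [], .nil, fun p' hp' l' hl' => ?_⟩
    cases hl'
    exact hp'
  | cons a l ih =>
    intro p e h he
    -- The slack in the energy is shared between the first segment and the rest of the chain.
    obtain ⟨e', he', he''⟩ : ∃ e', chainEnergy q a l < e' ∧ e' < e - segmentCost p a :=
      exists_between (by simp only [chainEnergy] at he; linarith)
    obtain ⟨U, hU, L, hL, H⟩ := ih h.2 he'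
    have h1 : ∀ᶠ z : (ℝ × ℝ) × (ℝ × ℝ) in 𝓝 (p, a), segmentCost z.1 z.2 < e - e' :=
      (continuousAt_segmentCost h.1).eventually_lt_const (by simp only; linarith)
    have h2 : ∀ᶠ z : (ℝ × ℝ) × (ℝ × ℝ) in 𝓝 (p, a), z.1.2 < z.2.2 :=
      ContinuousAt.eventually_lt (by fun_prop) (by fun_prop) h.1
    obtain ⟨V, hV, W, hW, hVW⟩ := mem_nhds_prod_iff.1 (h1.and h2)
    obtain ⟨B, hB, haB, hBsub⟩ := (TopologicalSpace.isBasis_countableBasis (ℝ × ℝ)).mem_nhds_iff.1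
      (Filter.inter_mem hU hW)
    refine ⟨V, hV, ⟨B, hB⟩ :: L, .cons haB hL, fun p' hp' l' hl' => ?_⟩
    cases hl' with
    | @cons a' _ l'' _ ha' hl'' =>
      have h3 := hBsub ha'
      have h4 := hVW (Set.mk_mem_prod hp' h3.2)
      have h5 := H a' h3.1 l'' hl''
      refine ⟨⟨h4.2, h5.1⟩, ?_⟩
      have h6 : segmentCost p' a' < e - e' := h4.1
      simp only [chainEnergy]
      linarith [h5.2]

open Classical in
-- The supremum becomes countable: the configuration enters only through which basic open boxes are
-- occupied, and the infimum over all chains through the boxes is deterministic.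
theorem iSup_chainGain_eq_iSup_boxes (s t : ℝ) (k : ℕ) (ω : Config) :
    (⨆ (l : List (ℝ × ℝ)) (_ : ∀ p ∈ l, p ∈ ω.points), chainGain s t k l) =
      ⨆ L : List (TopologicalSpace.countableBasis (ℝ × ℝ)),
        if ∀ B ∈ L, (ω.points ∩ B.1).Nonempty then
          ⨅ (l : List (ℝ × ℝ)) (_ : List.Forall₂ (fun a B => a ∈ B.1) l L), chainGain s t k l
        else 0 := by
  apply le_antisymm
  · refine iSup₂_le fun l hl => le_of_forall_lt fun c hc => ?_
    have hto : TimeOrdered (0, t) (0, s) l := by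
      by_contra hcon
      rw [chainGain, if_neg hcon] at hc
      exact not_lt_zero hc
    obtain ⟨c', hcc', hc'⟩ := exists_between hc
    rw [chainGain, if_pos hto] at hc'
    have hc't : c' ≠ ∞ := hc'.ne_top
    rw [ENNReal.lt_ofReal_iff_toReal_lt hc't] at hc'
    obtain ⟨U, hU, L, hL, H⟩ := TimeOrdered.exists_boxes l hto
      (e := (l.length + k : ℕ) - c'.toReal) (by linarith)
    refine hcc'.trans_le (le_iSup_of_le L ?_)
    rw [if_pos]
    · refine le_iInf₂ fun l' hl' => ?_
      have h1 := H _ (mem_of_mem_nhds hU) l' hl'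
      rw [chainGain, if_pos h1.1, ENNReal.le_ofReal_iff_toReal_le hc't]
      · rw [hl'.length_eq, ← hL.length_eq]; linarith [h1.2]
      · rw [hl'.length_eq, ← hL.length_eq]
        linarith [h1.2, ENNReal.toReal_nonneg (a := c')]
    · intro B hB
      obtain ⟨i, hi, rfl⟩ := List.mem_iff_getElem.1 hB
      have hi' : i < l.length := by rw [hL.length_eq]; exact hi
      exact ⟨l[i], hl _ (List.getElem_mem _), by simpa using hL.get hi' hi⟩
  · refine iSup_le fun L => ?_
    split_ifs with hocc
    · have : ∃ l : List (ℝ × ℝ), List.Forall₂ (fun a B => a ∈ B.1) l L ∧ ∀ p ∈ l, p ∈ ω.points := by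
        induction L with
        | nil => exact ⟨[], .nil, by simp⟩
        | cons B L ih =>
          obtain ⟨l, hl, hm⟩ := ih fun B' hB' => hocc B' (List.mem_cons_of_mem _ hB')
          obtain ⟨a, ha, haB⟩ := hocc B List.mem_cons_self
          refine ⟨a :: l, .cons haB hl, fun p hp => ?_⟩
          rcases List.mem_cons.1 hp with rfl | hp
          · exact ha
          · exact hm p hp
      obtain ⟨l, hl, hm⟩ := this
      exact (iInf₂_le l hl).trans (le_iSup₂_of_le l hm le_rfl)
    · exact zero_le

theorem Config.measurableSet_inter_nonempty {A : Set (ℝ × ℝ)} (hA : MeasurableSet A) :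
    MeasurableSet {ω : Config | (ω.points ∩ A).Nonempty} := by
  have : {ω : Config | (ω.points ∩ A).Nonempty} =
      ⋃ n : ℕ, (fun ω : Config => ω.count (A ∩ Metric.closedBall 0 n)) ⁻¹' {0}ᶜ := by
    ext ω
    simp only [Set.mem_ofPred_eq, Set.mem_iUnion, Set.mem_preimage, Set.mem_compl_iff,
      Set.mem_singleton_iff, Config.count]
    constructor
    · rintro ⟨p, hp, hpA⟩
      obtain ⟨n, hn⟩ := exists_nat_ge (dist p 0)
      exact ⟨n, ((Set.ncard_pos (ω.2 _
        (Metric.isBounded_closedBall.subset Set.inter_subset_right))).2 ⟨p, hp, hpA, hn⟩).ne'⟩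
    · rintro ⟨n, hn⟩
      obtain ⟨p, hp⟩ := Set.nonempty_of_ncard_ne_zero hn
      exact ⟨p, hp.1, hp.2.1⟩
  rw [this]
  refine MeasurableSet.iUnion fun n => ?_
  exact Config.measurable_count (hA.inter Metric.isClosed_closedBall.measurableSet)
    (Metric.isBounded_closedBall.subset Set.inter_subset_right) (MeasurableSet.of_discrete)

theorem measurable_maxGain {s t : ℝ} (hst : s < t) : Measurable (maxGain s t) := by
  classical
  have hG : ∀ k, Measurable fun ω : Config =>
      ⨆ (l : List (ℝ × ℝ)) (_ : ∀ p ∈ l, p ∈ ω.points), chainGain s t k l := by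
    intro k
    simp_rw [iSup_chainGain_eq_iSup_boxes]
    have : Countable (TopologicalSpace.countableBasis (ℝ × ℝ)) :=
      (TopologicalSpace.countable_countableBasis (ℝ × ℝ)).to_subtype
    refine Measurable.iSup fun L => Measurable.ite ?_ measurable_const measurable_const
    have : {ω : Config | ∀ B ∈ L, (ω.points ∩ B.1).Nonempty} =
        ⋂ B ∈ L, {ω : Config | (ω.points ∩ B.1).Nonempty} := by ext; simp
    rw [this]
    refine MeasurableSet.biInter (Set.to_countable {B | B ∈ L}) fun B _ =>
      Config.measurableSet_inter_nonempty ?_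
    exact ((TopologicalSpace.isBasis_countableBasis (ℝ × ℝ)).isOpen B.2).measurableSet
  have hset : MeasurableSet {ω : Config | ((0, s) : ℝ × ℝ) ∈ ω.points} := by
    have := Config.measurableSet_inter_nonempty (MeasurableSet.singleton ((0, s) : ℝ × ℝ))
    simpa [Set.inter_singleton_nonempty] using this
  -- The bonus for the starting point depends on `ω`; fixing its value `0` or `1` makes the chain
  -- gains deterministic.
  have : maxGain s t = fun ω => if ((0, s) : ℝ × ℝ) ∈ ω.points then
      ⨆ (l : List (ℝ × ℝ)) (_ : ∀ p ∈ l, p ∈ ω.points), chainGain s t 1 l else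
      ⨆ (l : List (ℝ × ℝ)) (_ : ∀ p ∈ l, p ∈ ω.points), chainGain s t 0 l := by
    ext ω
    rw [maxGain_eq_iSup_chainGain hst]
    by_cases h : ((0, s) : ℝ × ℝ) ∈ ω.points
    · rw [if_pos h, Config.indicatorAt, if_pos h]
    · rw [if_neg h, Config.indicatorAt, if_neg h]
  rw [this]
  exact Measurable.ite hset (hG 1) (hG 0)

/-! ### The space of configurations: counts, images, restrictions. -/

namespace Config

theorem measurable_of_count {X : Type*} [MeasurableSpace X] {f : X → Config}
    (h : ∀ A : Set (ℝ × ℝ), MeasurableSet A → Bornology.IsBounded A →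
      Measurable fun x => (f x).count A) : Measurable f := by
  rw [measurable_iff_comap_le]
  unfold instMeasurableSpace
  simp only [MeasurableSpace.comap_iSup, MeasurableSpace.comap_comp]
  exact iSup_le fun A => iSup_le fun hA => iSup_le fun hb => (h A hA hb).comap_le

/-- The family of all counts in bounded Borel sets. -/
noncomputable def counts (ω : Config)
    (A : {A : Set (ℝ × ℝ) // MeasurableSet A ∧ Bornology.IsBounded A}) : ℕ := ω.count A.1

theorem measurable_counts : Measurable counts :=
  measurable_pi_lambda _ fun A => measurable_count A.2.1 A.2.2

/-- Laws and independence on configurations can thus be tested on the family of counts, in a product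
space. -/
theorem instMeasurableSpace_eq_comap :
    instMeasurableSpace = MeasurableSpace.comap counts MeasurableSpace.pi := by
  apply le_antisymm
  · refine iSup_le fun A => iSup_le fun hA => iSup_le fun hb => ?_
    have : (fun ω : Config => ω.count A) = (fun v => v ⟨A, hA, hb⟩) ∘ counts := rfl
    rw [this, ← MeasurableSpace.comap_comp]
    exact MeasurableSpace.comap_mono (measurable_pi_apply _).comap_le
  · exact measurable_counts.comap_le

theorem count_biUnion {κ : Type*} (ω : Config) (T : Finset κ) (B : κ → Set (ℝ × ℝ))
    (hb : ∀ k, Bornology.IsBounded (B k)) (hd : Pairwise fun i j => Disjoint (B i) (B j)) :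
    ω.count (⋃ k ∈ T, B k) = ∑ k ∈ T, ω.count (B k) := by
  classical
  induction T using Finset.induction_on with
  | empty => simp [count]
  | insert a T ha ih =>
    rw [Finset.sum_insert ha, ← ih, Finset.set_biUnion_insert]
    unfold count
    rw [Set.inter_union_distrib_left]
    refine Set.ncard_union_eq ?_ (ω.2 _ (hb a)) (ω.2 _ ?_)
    · refine Disjoint.mono Set.inter_subset_right Set.inter_subset_right ?_
      refine Set.disjoint_iUnion₂_right.2 fun i hi => hd ?_
      rintro rfl; exact ha hi
    · exact (Bornology.isBounded_biUnion_finset T).2 fun i _ => hb i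

/-- The points lying in exactly those sets of a family whose index belongs to `S`. -/
def atom {ι : Type*} (A : ι → Set (ℝ × ℝ)) (S : Finset ι) : Set (ℝ × ℝ) :=
  {p | ∀ i, p ∈ A i ↔ i ∈ S}

theorem measurableSet_atom {ι : Type*} [Finite ι] {A : ι → Set (ℝ × ℝ)}
    (hA : ∀ i, MeasurableSet (A i)) (S : Finset ι) : MeasurableSet (atom A S) := by
  have : atom A S = ⋂ i, {p | p ∈ A i ↔ i ∈ S} := by ext; simp [atom]
  rw [this]
  refine MeasurableSet.iInter fun i => ?_
  by_cases h : i ∈ S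
  · simpa [h] using hA i
  · have : {p | p ∈ A i ↔ i ∈ S} = (A i)ᶜ := by ext p; simp [h]
    exact this ▸ (hA i).compl

theorem isBounded_atom {ι : Type*} {A : ι → Set (ℝ × ℝ)}
    (hA : ∀ i, Bornology.IsBounded (A i)) {S : Finset ι} (hS : S.Nonempty) :
    Bornology.IsBounded (atom A S) := by
  obtain ⟨i, hi⟩ := hS
  exact (hA i).subset fun p hp => (hp i).2 hi

theorem disjoint_atom {ι : Type*} (A : ι → Set (ℝ × ℝ)) {S T : Finset ι} (h : S ≠ T) :
    Disjoint (atom A S) (atom A T) := by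
  rw [Set.disjoint_left]
  intro p hS hT
  exact h (Finset.ext fun i => (hS i).symm.trans (hT i))

open Classical in
-- Overlapping sets are decomposed into disjoint atoms, to which the Poisson axioms apply. The empty
-- index set is excluded because its atom is unbounded when `ι` is finite and the `A i` are bounded.
theorem count_inter_eq_sum_atom {ι : Type*} [Fintype ι] (ω : Config) (A : ι → Set (ℝ × ℝ))
    (hA : ∀ i, Bornology.IsBounded (A i)) (R : Set (ℝ × ℝ)) (i : ι) :
    ω.count (A i ∩ R) =
      ∑ S ∈ (Finset.univ : Finset {S : Finset ι // S.Nonempty}) with i ∈ S.1,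
        ω.count (atom A S.1 ∩ R) := by
  rw [← count_biUnion ω _ (fun S : {S : Finset ι // S.Nonempty} => atom A S.1 ∩ R)]
  · congr 1
    ext p
    simp only [Set.mem_inter_iff, Finset.mem_filter, Finset.mem_univ, true_and, Set.mem_iUnion,
      exists_prop]
    constructor
    · rintro ⟨hp, hR⟩
      refine ⟨⟨Finset.univ.filter fun j => p ∈ A j, i, by simpa using hp⟩, by simpa using hp, ?_, hR⟩
      intro j
      simp
    · rintro ⟨S, hS, hp, hR⟩
      exact ⟨(hp i).2 hS, hR⟩
  · exact fun S => (isBounded_atom hA S.2).subset Set.inter_subset_left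
  · intro S T hST
    exact (disjoint_atom A fun h => hST (Subtype.ext h)).mono Set.inter_subset_left
      Set.inter_subset_left

theorem isBounded_preimage (e : (ℝ × ℝ) ≃ₜ (ℝ × ℝ)) {B : Set (ℝ × ℝ)}
    (hB : Bornology.IsBounded B) : Bornology.IsBounded (e ⁻¹' B) := by
  refine (hB.isCompact_closure.image e.symm.continuous).isBounded.subset fun p hp => ?_
  exact ⟨e p, subset_closure hp, by simp⟩

/-- The image of a configuration under a homeomorphism of space-time. -/
def map (e : (ℝ × ℝ) ≃ₜ (ℝ × ℝ)) (ω : Config) : Config :=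
  ⟨e '' ω.1, fun B hB => by
    rw [← Set.image_inter_preimage]
    exact (ω.2 _ (isBounded_preimage e hB)).image e⟩

theorem count_map (e : (ℝ × ℝ) ≃ₜ (ℝ × ℝ)) (ω : Config) (A : Set (ℝ × ℝ)) :
    (map e ω).count A = ω.count (e ⁻¹' A) := by
  change (e '' ω.1 ∩ A).ncard = (ω.1 ∩ e ⁻¹' A).ncard
  rw [← Set.image_inter_preimage, Set.ncard_image_of_injective _ e.injective]

theorem mem_points_map (e : (ℝ × ℝ) ≃ₜ (ℝ × ℝ)) (ω : Config) (p : ℝ × ℝ) :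
    e p ∈ (map e ω).points ↔ p ∈ ω.points :=
  e.injective.mem_set_image

theorem measurable_map (e : (ℝ × ℝ) ≃ₜ (ℝ × ℝ)) : Measurable (map e) :=
  measurable_of_count fun A hA hb => by
    simp_rw [count_map]
    exact measurable_count (e.measurable hA) (isBounded_preimage e hb)

/-- The points of a configuration inside a region. -/
def restrict (R : Set (ℝ × ℝ)) (ω : Config) : Config :=
  ⟨ω.1 ∩ R, fun B hB => (ω.2 B hB).subset (Set.inter_subset_inter_left _ Set.inter_subset_left)⟩

theorem count_restrict (R : Set (ℝ × ℝ)) (ω : Config) (A : Set (ℝ × ℝ)) :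
    (restrict R ω).count A = ω.count (A ∩ R) := by
  change (ω.1 ∩ R ∩ A).ncard = (ω.1 ∩ (A ∩ R)).ncard
  rw [Set.inter_assoc, Set.inter_comm R A]

theorem measurable_restrict {R : Set (ℝ × ℝ)} (hR : MeasurableSet R) : Measurable (restrict R) :=
  measurable_of_count fun A hA hb => by
    simp_rw [count_restrict]
    exact measurable_count (hA.inter hR) (hb.subset Set.inter_subset_left)

end Config

/-! ### The Poisson law: uniqueness, invariance, independence over disjoint regions. -/

namespace IsPoissonField

variable {P Q : Measure Config}

theorem iIndepFun_count (hP : IsPoissonField P) {κ : Type*} [Fintype κ] {A : κ → Set (ℝ × ℝ)}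
    (hA : ∀ k, MeasurableSet (A k)) (hb : ∀ k, Bornology.IsBounded (A k))
    (hd : Pairwise fun i j => Disjoint (A i) (A j)) :
    iIndepFun (fun k (ω : Config) => ω.count (A k)) P := by
  have e := Fintype.equivFin κ
  have := hP.indep_count _ (A ∘ e.symm) (fun i => hA _) (fun i => hb _)
    fun i j hij => hd (e.symm.injective.ne hij)
  simpa using this.precomp e.injective

theorem map_counts_eq [IsProbabilityMeasure P] [IsProbabilityMeasure Q] (hP : IsPoissonField P)
    (hQ : IsPoissonField Q) {ι : Type*} [Fintype ι] {A : ι → Set (ℝ × ℝ)}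
    (hA : ∀ i, MeasurableSet (A i)) (hb : ∀ i, Bornology.IsBounded (A i)) :
    P.map (fun ω i => ω.count (A i)) = Q.map (fun ω i => ω.count (A i)) := by
  classical
  let B : {S : Finset ι // S.Nonempty} → Set (ℝ × ℝ) := fun S => Config.atom A S.1
  have hBm : ∀ S, MeasurableSet (B S) := fun S => Config.measurableSet_atom hA _
  have hBb : ∀ S, Bornology.IsBounded (B S) := fun S => Config.isBounded_atom hb S.2
  have hBd : Pairwise fun i j => Disjoint (B i) (B j) := fun S T h =>
    Config.disjoint_atom A fun h' => h (Subtype.ext h')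
  let g : ({S : Finset ι // S.Nonempty} → ℕ) → ι → ℕ := fun v i => ∑ S with i ∈ S.1, v S
  have hg : Measurable g :=
    measurable_pi_lambda _ fun i => Finset.measurable_sum _ fun S _ => measurable_pi_apply S
  have hBmeas : Measurable fun (ω : Config) S => ω.count (B S) :=
    measurable_pi_lambda _ fun S => Config.measurable_count (hBm S) (hBb S)
  have hcomp : (fun (ω : Config) i => ω.count (A i)) = g ∘ fun ω S => ω.count (B S) := by
    ext ω i
    simpa [g, B] using ω.count_inter_eq_sum_atom A hb Set.univ i
  have key : ∀ (P : Measure Config) [IsProbabilityMeasure P], IsPoissonField P →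
      P.map (fun ω S => ω.count (B S)) =
        Measure.pi fun S => poissonMeasure (volume (B S)).toNNReal := by
    intro P _ hP
    rw [(iIndepFun_iff_map_fun_eq_pi_map
      fun S => (Config.measurable_count (hBm S) (hBb S)).aemeasurable).1
      (hP.iIndepFun_count hBm hBb hBd)]
    congr 1
    ext1 S
    exact hP.law_count _ (hBm S) (hBb S)
  rw [hcomp, ← Measure.map_map hg hBmeas, ← Measure.map_map hg hBmeas, key P hP, key Q hQ]

/-- The finite-dimensional laws of the counts are determined, and a projective limit of finite
measures is unique. This turns invariance of Lebesgue measure into invariance of `P`. -/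
theorem eq_of_isPoissonField [IsProbabilityMeasure P] [IsProbabilityMeasure Q]
    (hP : IsPoissonField P) (hQ : IsPoissonField Q) : P = Q := by
  have hmap : P.map Config.counts = Q.map Config.counts := by
    have h1 := isProjectiveLimit_map (P := P) (X := fun A ω => Config.counts ω A)
      Config.measurable_counts.aemeasurable
    have h2 := isProjectiveLimit_map (P := Q) (X := fun A ω => Config.counts ω A)
      Config.measurable_counts.aemeasurable
    have : (fun I : Finset {A : Set (ℝ × ℝ) // MeasurableSet A ∧ Bornology.IsBounded A} =>
        P.map fun ω => I.restrict (Config.counts ω)) =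
        fun I => Q.map fun ω => I.restrict (Config.counts ω) := by
      ext1 I
      exact hP.map_counts_eq hQ (A := fun i : I => i.1.1) (fun i => i.1.2.1) fun i => i.1.2.2
    have h3 : IsProjectiveLimit (Q.map Config.counts)
      (fun I => P.map fun ω => I.restrict (Config.counts ω)) := this ▸ h2
    exact IsProjectiveLimit.unique h1 h3
  ext s hs
  rw [Config.instMeasurableSpace_eq_comap] at hs
  obtain ⟨S, hS, rfl⟩ := hs
  rw [← Measure.map_apply Config.measurable_counts hS, hmap,
    Measure.map_apply Config.measurable_counts hS]

theorem map (hP : IsPoissonField P) {e : (ℝ × ℝ) ≃ₜ (ℝ × ℝ)}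
    (he : MeasurePreserving e volume volume) : IsPoissonField (P.map (Config.map e)) where
  law_count A hA hb := by
    rw [Measure.map_map (Config.measurable_count hA hb) (Config.measurable_map e)]
    have : ((fun ω : Config => ω.count A) ∘ Config.map e) = fun ω => ω.count (e ⁻¹' A) := by
      ext ω; exact Config.count_map e ω A
    rw [this, hP.law_count _ (e.measurable hA) (Config.isBounded_preimage e hb),
      he.measure_preimage hA.nullMeasurableSet]
  indep_count m A hA hb hd := by
    have h := hP.indep_count m (fun i => e ⁻¹' A i) (fun i => e.measurable (hA i))
      (fun i => Config.isBounded_preimage e (hb i)) fun i j hij => (hd hij).preimage e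
    simp_rw [← Config.count_map] at h
    have hc : ∀ i, Measurable fun ω : Config => ω.count (A i) :=
      fun i => Config.measurable_count (hA i) (hb i)
    rw [iIndepFun_iff_measure_inter_preimage_eq_mul] at h ⊢
    intro S sets hsets
    have h1 := h S hsets
    have h2 : ∀ i, MeasurableSet ((fun ω : Config => ω.count (A i)) ⁻¹' sets i) :=
      fun i => hc i .of_discrete
    rw [Measure.map_apply (Config.measurable_map e) (S.measurableSet_biInter fun i _ => h2 i)]
    simp_rw [Measure.map_apply (Config.measurable_map e) (h2 _)]
    simp only [Set.preimage_iInter]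
    exact h1

theorem measurePreserving_map [IsProbabilityMeasure P] (hP : IsPoissonField P)
    {e : (ℝ × ℝ) ≃ₜ (ℝ × ℝ)} (he : MeasurePreserving e volume volume) :
    MeasurePreserving (Config.map e) P P := by
  have := Measure.isProbabilityMeasure_map (μ := P) (Config.measurable_map e).aemeasurable
  exact ⟨Config.measurable_map e, (hP.map he).eq_of_isPoissonField hP⟩

theorem indepFun_count_inter [IsProbabilityMeasure P] (hP : IsPoissonField P) {R : Set (ℝ × ℝ)}
    (hR : MeasurableSet R) {ι : Type*} [Fintype ι] {A : ι → Set (ℝ × ℝ)}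
    (hA : ∀ i, MeasurableSet (A i)) (hb : ∀ i, Bornology.IsBounded (A i)) :
    IndepFun (fun ω i => ω.count (A i ∩ R)) (fun ω i => ω.count (A i ∩ Rᶜ)) P := by
  classical
  let Rb : Bool → Set (ℝ × ℝ) := fun b => if b then R else Rᶜ
  have hRb : ∀ b, MeasurableSet (Rb b) := by
    rintro (_ | _)
    · exact hR.compl
    · exact hR
  let B : {S : Finset ι // S.Nonempty} × Bool → Set (ℝ × ℝ) :=
    fun k => Config.atom A k.1.1 ∩ Rb k.2
  have hBm : ∀ k, MeasurableSet (B k) := fun k =>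
    (Config.measurableSet_atom hA _).inter (hRb _)
  have hBb : ∀ k, Bornology.IsBounded (B k) := fun k =>
    (Config.isBounded_atom hb k.1.2).subset Set.inter_subset_left
  have hBd : Pairwise fun i j => Disjoint (B i) (B j) := by
    rintro ⟨S, b⟩ ⟨T, c⟩ hne
    by_cases hST : S = T
    · subst hST
      have hbc : b ≠ c := fun h => hne (by rw [h])
      refine Disjoint.mono Set.inter_subset_right Set.inter_subset_right ?_
      rcases b with _ | _ <;> rcases c with _ | _
      · exact absurd rfl hbc
      · exact disjoint_compl_left
      · exact disjoint_compl_right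
      · exact absurd rfl hbc
    · exact (Config.disjoint_atom A fun h => hST (Subtype.ext h)).mono Set.inter_subset_left
        Set.inter_subset_left
  have hind := (hP.iIndepFun_count hBm hBb hBd).indepFun_finset
    (Finset.univ ×ˢ {true}) (Finset.univ ×ˢ {false})
    (by
      rw [Finset.disjoint_left]
      rintro ⟨S, b⟩ h1 h2
      simp only [Finset.mem_product, Finset.mem_univ, Finset.mem_singleton, true_and] at h1 h2
      exact Bool.noConfusion (h1.symm.trans h2))
    fun k => Config.measurable_count (hBm k) (hBb k)
  let g : ∀ b : Bool,
      (↥((Finset.univ : Finset {S : Finset ι // S.Nonempty}) ×ˢ {b}) → ℕ) → ι → ℕ :=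
    fun b v i => ∑ S ∈ (Finset.univ : Finset {S : Finset ι // S.Nonempty}) with i ∈ S.1,
      v ⟨(S, b), by simp⟩
  have hg : ∀ b, Measurable (g b) := fun b =>
    measurable_pi_lambda _ fun i => Finset.measurable_sum _ fun S _ => measurable_pi_apply _
  have e : ∀ b, (fun (ω : Config) i => ω.count (A i ∩ Rb b)) =
      g b ∘ fun ω k => ω.count (B k.1) := by
    intro b
    funext ω i
    refine (ω.count_inter_eq_sum_atom A hb (Rb b) i).trans ?_
    simp only [Function.comp_apply, g, B]
  have h2 := hind.comp (hg true) (hg false)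
  rw [← e true, ← e false] at h2
  exact h2

/-- Independence of finitely many counts inside and outside `R` extends to the generated σ-algebras.
It is used with `R` the past of a given time. -/
theorem indepFun_restrict [IsProbabilityMeasure P] (hP : IsPoissonField P) {R : Set (ℝ × ℝ)}
    (hR : MeasurableSet R) : IndepFun (Config.restrict R) (Config.restrict Rᶜ) P := by
  classical
  have main : IndepFun (fun ω => Config.counts (Config.restrict R ω))
      (fun ω => Config.counts (Config.restrict Rᶜ ω)) P := by
    refine IndepFun.process_indepFun_process
      (fun A => (measurable_pi_apply A).comp
        (Config.measurable_counts.comp (Config.measurable_restrict hR)))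
      (fun A => (measurable_pi_apply A).comp
        (Config.measurable_counts.comp (Config.measurable_restrict hR.compl))) fun I J => ?_
    have h := hP.indepFun_count_inter hR (A := fun i : ↥(I ∪ J) => i.1.1)
      (fun i => i.1.2.1) (fun i => i.1.2.2)
    have h2 := h.comp
      (measurable_pi_lambda (fun (v : ↥(I ∪ J) → ℕ) (i : I) =>
        v ⟨i.1, Finset.subset_union_left i.2⟩) fun i => measurable_pi_apply _)
      (measurable_pi_lambda (fun (v : ↥(I ∪ J) → ℕ) (i : J) =>
        v ⟨i.1, Finset.subset_union_right i.2⟩) fun i => measurable_pi_apply _)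
    simp only [Config.counts, Config.count_restrict]
    exact h2
  rw [IndepFun_iff_Indep] at main ⊢
  have e : ∀ R, MeasurableSpace.comap (Config.restrict R) Config.instMeasurableSpace =
      MeasurableSpace.comap (fun ω => Config.counts (Config.restrict R ω)) MeasurableSpace.pi := by
    intro R
    rw [Config.instMeasurableSpace_eq_comap, MeasurableSpace.comap_comp]
    rfl
  rw [e, e]
  exact main

end IsPoissonField

/-! ### Exponential moments by a unit-time partition sum, and almost sure existence of minimizers.
-/

/-- The space-time box seen during `[T + k, T + k + 1)` by a path which starts this time interval
in `[a, a + 1)` and is displaced by less than `ρ + 1`. -/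
def slabBox (T : ℝ) (k : ℕ) (a : ℤ) (ρ : ℕ) : Set (ℝ × ℝ) :=
  Set.Icc ((a : ℝ) - ρ - 1) (a + ρ + 2) ×ˢ Set.Ico (T + k) (T + k + 1)

theorem measurableSet_slabBox (T : ℝ) (k : ℕ) (a : ℤ) (ρ : ℕ) : MeasurableSet (slabBox T k a ρ) :=
  measurableSet_Icc.prod measurableSet_Ico

theorem isBounded_slabBox (T : ℝ) (k : ℕ) (a : ℤ) (ρ : ℕ) :
    Bornology.IsBounded (slabBox T k a ρ) :=
  (Metric.isBounded_Icc _ _).prod (Metric.isBounded_Ico _ _)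

theorem volume_slabBox (T : ℝ) (k : ℕ) (a : ℤ) (ρ : ℕ) :
    volume (slabBox T k a ρ) = ENNReal.ofReal (2 * ρ + 3) := by
  rw [slabBox, Measure.volume_eq_prod, Measure.prod_prod, Real.volume_Icc, Real.volume_Ico]
  have : T + k + 1 - (T + k) = 1 := by ring
  rw [this, ENNReal.ofReal_one, mul_one]
  congr 1
  ring

/-- Bound for the exponential of visits minus half the kinetic action over one unit of time. -/
noncomputable def slabWeight (T : ℝ) (k : ℕ) (a : ℤ) (ρ : ℕ) (ω : Config) : ℝ≥0∞ :=
  ENNReal.ofReal (Real.exp (ω.count (slabBox T k a ρ) - (ρ : ℝ) ^ 2 / 4))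

/-- Recursive bound for the exponential of visits minus half the kinetic action of paths from
`(0, T)` to `[b, b + 1) × {T + k}`. -/
noncomputable def partitionBound (T : ℝ) (ω : Config) : ℕ → ℤ → ℝ≥0∞
  | 0, b => if b = 0 then 1 else 0
  | k + 1, b => ∑' a : ℤ, ∑' ρ : ℕ,
      if |b - a| ≤ ρ + 1 then partitionBound T ω k a * slabWeight T k a ρ ω else 0

theorem measurable_slabWeight (T : ℝ) (k : ℕ) (a : ℤ) (ρ : ℕ) : Measurable (slabWeight T k a ρ) := by
  have h := Config.measurable_count (measurableSet_slabBox T k a ρ) (isBounded_slabBox T k a ρ)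
  have : slabWeight T k a ρ =
    (fun n : ℕ => ENNReal.ofReal (Real.exp (n - (ρ : ℝ) ^ 2 / 4))) ∘
      fun ω : Config => ω.count (slabBox T k a ρ) := rfl
  rw [this]
  exact Measurable.of_discrete.comp h

theorem measurable_partitionBound (T : ℝ) (n : ℕ) : ∀ b : ℤ,
    Measurable fun ω => partitionBound T ω n b := by
  induction n with
  | zero => exact fun b => measurable_const
  | succ k ih =>
    intro b
    refine Measurable.tsum fun a => Measurable.tsum fun ρ => ?_
    split_ifs
    · exact (ih a).mul (measurable_slabWeight T k a ρ)
    · exact measurable_const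

theorem slabWeight_restrict {T : ℝ} {k : ℕ} {a : ℤ} {ρ : ℕ} {R : Set (ℝ × ℝ)}
    (h : slabBox T k a ρ ⊆ R) (ω : Config) :
    slabWeight T k a ρ (Config.restrict R ω) = slabWeight T k a ρ ω := by
  rw [slabWeight, Config.count_restrict, Set.inter_eq_left.2 h, slabWeight]

theorem partitionBound_restrict (T u : ℝ) (ω : Config) (n : ℕ) : T + n ≤ u → ∀ b : ℤ,
    partitionBound T (Config.restrict {p | p.2 < u} ω) n b = partitionBound T ω n b := by
  induction n with
  | zero => exact fun _ b => rfl
  | succ k ih =>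
    intro hu b
    push_cast at hu
    simp only [partitionBound]
    refine tsum_congr fun a => tsum_congr fun ρ => ?_
    rw [ih (by linarith) a, slabWeight_restrict]
    rintro p ⟨-, -, hp⟩
    exact lt_of_lt_of_le hp (by linarith)

/-- In the last slab let `a` be the integer part of the entrance position and `ρ` that of the
largest displacement. The visits lie in the slab box, half the action is at least `ρ² / 4`, and the
resulting product is a single term of the sum defining the bound. -/
theorem exp_le_partitionBound (T : ℝ) (ω : Config) {γ : ℝ → ℝ} (n : ℕ) : ∀ {y : ℝ},
    IsPath T (T + n) 0 y γ →
    ENNReal.ofReal (Real.exp (visits ω T (T + n) γ - kineticAction T (T + n) γ / 2)) ≤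
      partitionBound T ω n ⌊y⌋ := by
  induction n with
  | zero =>
    intro y h
    have h1 : y = 0 := by
      rw [← h.end_eq, ← h.start_eq]; simp
    subst h1
    simp [visits, kineticAction, Config.count, partitionBound]
  | succ k ih =>
    intro y h
    have hle : T ≤ T + k := by linarith [Nat.cast_nonneg (α := ℝ) k]
    have hle' : T + k ≤ T + (k + 1 : ℕ) := by push_cast; linarith
    have hone : T + (k + 1 : ℕ) = T + k + 1 := by push_cast; ring
    have h1 := h.mono le_rfl hle hle'
    have h2 := h.mono hle hle' le_rfl
    rw [h.start_eq] at h1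
    rw [h.end_eq] at h2
    have hc : ContinuousOn (fun r => |γ r - γ (T + k)|) (Set.Icc (T + k) (T + (k + 1 : ℕ))) :=
      ((h2.continuousOn hle').sub continuousOn_const).abs
    obtain ⟨m, hm, hmax⟩ := isCompact_Icc.exists_isMaxOn (Set.nonempty_Icc.2 hle') hc
    set ρ := ⌊|γ m - γ (T + k)|⌋₊
    have hlt : ∀ r ∈ Set.Icc (T + k) (T + (k + 1 : ℕ)), |γ r - γ (T + k)| < ρ + 1 :=
      fun r hr => (hmax hr).trans_lt (Nat.lt_floor_add_one _)
    set a := ⌊γ (T + k)⌋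
    have ha1 : (a : ℝ) ≤ γ (T + k) := Int.floor_le _
    have ha2 : γ (T + k) < a + 1 := Int.lt_floor_add_one _
    have hcount : visits ω (T + k) (T + (k + 1 : ℕ)) γ ≤ ω.count (slabBox T k a ρ) := by
      refine visits_le_count (isBounded_slabBox _ _ _ _) fun u hu => ⟨?_, ?_⟩
      · have := abs_lt.1 (hlt u ⟨hu.1, hu.2.le⟩)
        exact ⟨by simp only; linarith, by simp only; linarith⟩
      · rwa [hone] at hu
    have hkin : (ρ : ℝ) ^ 2 / 4 ≤ kineticAction (T + k) (T + (k + 1 : ℕ)) γ / 2 := by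
      have h3 := h2.sq_le_kineticAction hm
      have h4 : (ρ : ℝ) ≤ |γ m - γ (T + k)| := Nat.floor_le (abs_nonneg _)
      have h5 : (ρ : ℝ) ^ 2 ≤ (γ m - γ (T + k)) ^ 2 := by
        rw [← sq_abs (γ m - _)]; gcongr
      rw [hone] at h3 ⊢
      have : 2 * (T + k + 1 - (T + k)) = 2 := by ring
      rw [this] at h3
      linarith
    -- The displacement is below `ρ + 1`; the two floors add an error below `1`, and integrality
    -- gives `ρ + 1` rather than `ρ + 2`.
    have hdist : |⌊y⌋ - a| ≤ (ρ : ℤ) + 1 := by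
      have h3 := abs_lt.1 (hlt _ ⟨hle', le_rfl⟩)
      rw [h.end_eq] at h3
      have h4 := Int.floor_le y
      have h5 := Int.lt_floor_add_one y
      have h6 : (⌊y⌋ : ℝ) < ((a + ρ + 2 : ℤ) : ℝ) := by push_cast; linarith
      have h7 : ((a - ρ - 2 : ℤ) : ℝ) < (⌊y⌋ : ℝ) := by push_cast; linarith
      rw [Int.cast_lt] at h6 h7
      rw [abs_le]
      constructor <;> omega
    calc ENNReal.ofReal (Real.exp (visits ω T (T + (k + 1 : ℕ)) γ -
          kineticAction T (T + (k + 1 : ℕ)) γ / 2))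
        ≤ ENNReal.ofReal (Real.exp (visits ω T (T + k) γ - kineticAction T (T + k) γ / 2)) *
          slabWeight T k a ρ ω := by
          rw [slabWeight, ← ENNReal.ofReal_mul (Real.exp_nonneg _), ← Real.exp_add]
          refine ENNReal.ofReal_le_ofReal (Real.exp_le_exp.2 ?_)
          rw [visits_add ω hle hle' (h.continuousOn (hle.trans hle')),
            h.kineticAction_add hle hle']
          have : (visits ω (T + k) (T + (k + 1 : ℕ)) γ : ℝ) ≤ ω.count (slabBox T k a ρ) := by
            exact_mod_cast hcount
          push_cast at this hkin ⊢
          linarith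
      _ ≤ partitionBound T ω k a * slabWeight T k a ρ ω := by gcongr; exact ih h1
      _ ≤ partitionBound T ω (k + 1) ⌊y⌋ := by
          have e : partitionBound T ω k a * slabWeight T k a ρ ω =
            if |⌊y⌋ - a| ≤ (ρ : ℤ) + 1 then
              partitionBound T ω k a * slabWeight T k a ρ ω else 0 := (if_pos hdist).symm
          rw [e]
          exact (ENNReal.le_tsum ρ).trans (ENNReal.le_tsum
            (f := fun a : ℤ => ∑' ρ : ℕ, if |⌊y⌋ - a| ≤ (ρ : ℤ) + 1 then
              partitionBound T ω k a * slabWeight T k a ρ ω else 0) a)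

theorem lintegral_exp_poissonMeasure (r : ℝ≥0) (c : ℝ) :
    ∫⁻ n, ENNReal.ofReal (Real.exp (n - c)) ∂poissonMeasure r =
      ENNReal.ofReal (Real.exp ((Real.exp 1 - 1) * r - c)) := by
  rw [poissonMeasure, lintegral_sum_measure]
  have hs : HasSum (fun n : ℕ => Real.exp (-r) * (r : ℝ) ^ n / n.factorial * Real.exp (n - c))
      (Real.exp ((Real.exp 1 - 1) * r - c)) := by
    have h := (NormedSpace.expSeries_div_hasSum_exp ((r : ℝ) * Real.exp 1)).mul_left
      (Real.exp (-r - c))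
    rw [← Real.exp_eq_exp_ℝ, ← Real.exp_add] at h
    have e : -(r : ℝ) - c + r * Real.exp 1 = (Real.exp 1 - 1) * r - c := by ring
    rw [e] at h
    refine h.congr_fun fun n => ?_
    rw [mul_pow, ← Real.exp_nat_mul, mul_one, sub_eq_add_neg, Real.exp_add,
      sub_eq_add_neg (-(r : ℝ)), Real.exp_add]
    ring
  simp_rw [lintegral_smul_measure, lintegral_dirac, smul_eq_mul,
    ← ENNReal.ofReal_mul (div_nonneg (mul_nonneg (Real.exp_nonneg _)
      (pow_nonneg (NNReal.coe_nonneg r) _)) (Nat.cast_nonneg _))]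
  rw [← ENNReal.ofReal_tsum_of_nonneg (fun n => by positivity) hs.summable, hs.tsum_eq]

/-- Expected growth factor of `partitionBound` per unit of time. -/
noncomputable def growthFactor : ℝ≥0∞ :=
  ∑' ρ : ℕ, ENNReal.ofReal
    ((2 * ρ + 3) * Real.exp ((Real.exp 1 - 1) * (2 * ρ + 3) - (ρ : ℝ) ^ 2 / 4))

theorem growthFactor_ne_top : growthFactor ≠ ∞ := by
  have hsum : Summable fun ρ : ℕ =>
      (2 * ρ + 3) * Real.exp ((Real.exp 1 - 1) * (2 * ρ + 3) - (ρ : ℝ) ^ 2 / 4) := by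
    -- With `e ≤ 3` the exponent is at most `6ρ + 9 - ρ² / 4`, and this equals `58 - ρ - (ρ - 14)² /
    -- 4`.
    refine Summable.of_nonneg_of_le (fun ρ => by positivity) (fun ρ => ?_)
      (Real.summable_exp_neg_nat.mul_left (Real.exp 58))
    have h1 : (2 * ρ + 3 : ℝ) ≤ Real.exp (2 * ρ + 3) := by
      linarith [Real.add_one_le_exp (2 * ρ + 3 : ℝ)]
    refine (mul_le_mul_of_nonneg_right h1 (Real.exp_nonneg _)).trans ?_
    rw [← Real.exp_add, ← Real.exp_add]
    refine Real.exp_le_exp.2 ?_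
    have h2 : Real.exp 1 ≤ 3 := Real.exp_one_lt_three.le
    have h3 : (0 : ℝ) ≤ ρ := Nat.cast_nonneg _
    nlinarith [sq_nonneg ((ρ : ℝ) - 14)]
  rw [growthFactor, ← ENNReal.ofReal_tsum_of_nonneg (fun ρ => by positivity) hsum]
  exact ENNReal.ofReal_ne_top

theorem tsum_ite_abs_sub_le (a : ℤ) (ρ : ℕ) (c : ℝ≥0∞) :
    ∑' b : ℤ, (if |b - a| ≤ (ρ : ℤ) + 1 then c else 0) = ENNReal.ofReal (2 * ρ + 3) * c := by
  rw [tsum_eq_sum (s := Finset.Icc (a - (ρ + 1)) (a + (ρ + 1)))]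
  · rw [Finset.sum_congr rfl (g := fun _ => c)]
    · rw [Finset.sum_const, nsmul_eq_mul, Int.card_Icc]
      congr 1
      have : (a + (ρ + 1) + 1 - (a - (ρ + 1))).toNat = 2 * ρ + 3 := by omega
      rw [this, ← ENNReal.ofReal_natCast]
      push_cast; rfl
    · intro b hb
      rw [if_pos]
      rw [Finset.mem_Icc] at hb
      rw [abs_le]; constructor <;> omega
  · intro b hb
    rw [if_neg]
    intro h
    rw [abs_le] at h
    refine hb (Finset.mem_Icc.2 ⟨by omega, by omega⟩)

theorem IsPoissonField.lintegral_slabWeight {P : Measure Config} (hP : IsPoissonField P) (T : ℝ)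
    (k : ℕ) (a : ℤ) (ρ : ℕ) : ∫⁻ ω, slabWeight T k a ρ ω ∂P =
      ENNReal.ofReal (Real.exp ((Real.exp 1 - 1) * (2 * ρ + 3) - (ρ : ℝ) ^ 2 / 4)) := by
  have hm := Config.measurable_count (measurableSet_slabBox T k a ρ) (isBounded_slabBox T k a ρ)
  have h := lintegral_map (μ := P)
    (f := fun n : ℕ => ENNReal.ofReal (Real.exp (n - (ρ : ℝ) ^ 2 / 4))) .of_discrete hm
  rw [hP.law_count _ (measurableSet_slabBox T k a ρ) (isBounded_slabBox T k a ρ),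
    lintegral_exp_poissonMeasure, volume_slabBox] at h
  have hr : (((ENNReal.ofReal (2 * ρ + 3)).toNNReal : ℝ≥0) : ℝ) = 2 * ρ + 3 :=
    ENNReal.toReal_ofReal (by positivity)
  rw [hr] at h
  exact h.symm

/-- The bound up to time `T + k` depends only on the points before `T + k`, the next slab weight
only on later ones, so expectations factor. Summing over end cells `b` first gives the factor `2ρ +
3`, and the expected slab weight does not depend on `a`. -/
theorem IsPoissonField.lintegral_tsum_partitionBound {P : Measure Config} [IsProbabilityMeasure P]
    (hP : IsPoissonField P) (T : ℝ) (n : ℕ) :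
    ∫⁻ ω, ∑' b : ℤ, partitionBound T ω n b ∂P = growthFactor ^ n := by
  induction n with
  | zero =>
    have : ∀ ω, ∑' b : ℤ, partitionBound T ω 0 b = 1 := fun ω => by
      simp [partitionBound]
    simp [this]
  | succ k ih =>
    have hR : MeasurableSet {p : ℝ × ℝ | p.2 < T + k} := measurableSet_lt measurable_snd measurable_const
    have hind := hP.indepFun_restrict hR
    have hprod : ∀ (a : ℤ) (ρ : ℕ), ∫⁻ ω, partitionBound T ω k a * slabWeight T k a ρ ω ∂P =
        (∫⁻ ω, partitionBound T ω k a ∂P) *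
          ENNReal.ofReal (Real.exp ((Real.exp 1 - 1) * (2 * ρ + 3) - (ρ : ℝ) ^ 2 / 4)) := by
      intro a ρ
      rw [← hP.lintegral_slabWeight T k a ρ]
      refine lintegral_mul_eq_lintegral_mul_lintegral_of_indepFun
        (measurable_partitionBound T k a) (measurable_slabWeight T k a ρ) ?_
      have := hind.comp (measurable_partitionBound T k a) (measurable_slabWeight T k a ρ)
      convert this using 1
      · ext ω; exact (partitionBound_restrict T (T + k) ω k le_rfl a).symm
      · ext ω
        refine (slabWeight_restrict ?_ ω).symm
        rintro p ⟨-, hp, -⟩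
        exact not_lt.2 hp
    have hm := measurable_partitionBound T k
    have hmeas : ∀ (b a : ℤ) (ρ : ℕ), Measurable fun ω => if |b - a| ≤ (ρ : ℤ) + 1 then
        partitionBound T ω k a * slabWeight T k a ρ ω else 0 := by
      intro b a ρ
      split_ifs
      · exact (hm a).mul (measurable_slabWeight T k a ρ)
      · exact measurable_const
    calc ∫⁻ ω, ∑' b : ℤ, partitionBound T ω (k + 1) b ∂P
        = ∫⁻ ω, ∑' a : ℤ, ∑' ρ : ℕ, ENNReal.ofReal (2 * ρ + 3) *
            (partitionBound T ω k a * slabWeight T k a ρ ω) ∂P := by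
          refine lintegral_congr fun ω => ?_
          simp only [partitionBound]
          rw [ENNReal.tsum_comm]
          refine tsum_congr fun a => ?_
          rw [ENNReal.tsum_comm]
          exact tsum_congr fun ρ => tsum_ite_abs_sub_le a ρ _
      _ = ∑' a : ℤ, ∑' ρ : ℕ, ENNReal.ofReal (2 * ρ + 3) *
            ((∫⁻ ω, partitionBound T ω k a ∂P) * ENNReal.ofReal
              (Real.exp ((Real.exp 1 - 1) * (2 * ρ + 3) - (ρ : ℝ) ^ 2 / 4))) := by
          have h1 : ∀ (a : ℤ) (ρ : ℕ), Measurable fun ω =>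
              partitionBound T ω k a * slabWeight T k a ρ ω :=
            fun a ρ => (hm a).mul (measurable_slabWeight T k a ρ)
          rw [lintegral_tsum fun a =>
            (Measurable.tsum fun ρ => (h1 a ρ).const_mul _).aemeasurable]
          refine tsum_congr fun a => ?_
          rw [lintegral_tsum fun ρ => ((h1 a ρ).const_mul _).aemeasurable]
          refine tsum_congr fun ρ => ?_
          rw [lintegral_const_mul _ (h1 a ρ), hprod]
      _ = ∑' a : ℤ, (∫⁻ ω, partitionBound T ω k a ∂P) * growthFactor := by
          refine tsum_congr fun a => ?_
          rw [growthFactor, ← ENNReal.tsum_mul_left]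
          refine tsum_congr fun ρ => ?_
          rw [ENNReal.ofReal_mul (by positivity), mul_left_comm]
      _ = growthFactor ^ (k + 1) := by
          rw [ENNReal.tsum_mul_right, ← lintegral_tsum fun a => (hm a).aemeasurable, ih, pow_succ]

theorem IsPath.exp_le_tsum_partitionBound {T y : ℝ} (ω : Config) {γ : ℝ → ℝ} {n : ℕ}
    (h : IsPath T (T + n) 0 y γ) :
    ENNReal.ofReal (Real.exp (visits ω T (T + n) γ - kineticAction T (T + n) γ / 2)) ≤
      ∑' b : ℤ, partitionBound T ω n b :=
  (exp_le_partitionBound T ω n h).trans (ENNReal.le_tsum ⌊y⌋)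

theorem IsPoissonField.ae_partitionBound_ne_top {P : Measure Config} [IsProbabilityMeasure P]
    (hP : IsPoissonField P) (T : ℝ) (n : ℕ) :
    ∀ᵐ ω ∂P, ∑' b : ℤ, partitionBound T ω n b ≠ ∞ := by
  have hm : Measurable fun ω => ∑' b : ℤ, partitionBound T ω n b :=
    Measurable.tsum fun b => measurable_partitionBound T n b
  filter_upwards [ae_lt_top hm (by
    rw [hP.lintegral_tsum_partitionBound]
    exact ENNReal.pow_ne_top growthFactor_ne_top)] with ω hω using hω.ne

/-- Countably many bounds, one for each window `[-N, N]`, serve all endpoints at once: any path is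
extended by a segment from `(0, -N)` and a constant piece up to time `N`. The extension costs a
fixed amount and loses no visits. -/
theorem IsPoissonField.ae_isLeast_optimalAction {P : Measure Config} [IsProbabilityMeasure P]
    (hP : IsPoissonField P) : ∀ᵐ ω ∂P, ∀ s t x y : ℝ, s < t →
      IsLeast (pathActions ω s t x y) (optimalAction ω s t x y) := by
  have h := ae_all_iff.2 fun N : ℕ => hP.ae_partitionBound_ne_top (-(N : ℝ)) (2 * N)
  filter_upwards [h] with ω hω s t x y hst
  obtain ⟨N, hN⟩ := exists_nat_gt (max |s| |t|)
  have hs := abs_lt.1 ((le_max_left _ _).trans_lt hN)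
  have ht := abs_lt.1 ((le_max_right _ _).trans_lt hN)
  set S := ∑' b : ℤ, partitionBound (-(N : ℝ)) ω (2 * N) b
  obtain ⟨γ₁, h₁, hk₁⟩ := exists_isPath_kineticAction_eq hs.1 0 x
  obtain ⟨γ₃, h₃, hk₃⟩ := exists_isPath_kineticAction_eq ht.2 y y
  refine isLeast_optimalAction (C := Real.log S.toReal + kineticAction (-N) s γ₁ / 2) hst
    fun γ hγ => ?_
  obtain ⟨γ', h', e₁, e₂⟩ := h₁.glue hs.1.le hst.le hγ
  have hNt : -(N : ℝ) ≤ t := hs.1.le.trans hst.le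
  obtain ⟨γ'', h'', e₁', e₂'⟩ := h'.glue hNt ht.2.le h₃
  have hend : (N : ℝ) = -N + (2 * N : ℕ) := by push_cast; ring
  have hv : visits ω s t γ ≤ visits ω (-N) N γ'' := by
    rw [visits_add ω hNt ht.2.le (h''.continuousOn (hNt.trans ht.2.le)),
      visits_congr (ω := ω) (ω' := ω) (fun u hu => e₁' u ⟨hu.1, hu.2.le⟩) (fun _ _ => Iff.rfl),
      visits_add ω hs.1.le hst.le (h'.continuousOn hNt),
      visits_congr (ω := ω) (ω' := ω) (s := s)
        (fun u hu => e₂ u ⟨hu.1, hu.2.le⟩) (fun _ _ => Iff.rfl)]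
    omega
  have hk : kineticAction (-N) N γ'' = kineticAction (-N) s γ₁ + kineticAction s t γ := by
    rw [h''.kineticAction_add hNt ht.2.le, h'.kineticAction_congr hNt e₁',
      h₃.kineticAction_congr ht.2.le e₂', hk₃, h'.kineticAction_add hs.1.le hst.le,
      h₁.kineticAction_congr hs.1.le e₁, hγ.kineticAction_congr hst.le e₂]
    simp
  have h₄ : IsPath (-(N : ℝ)) (-N + (2 * N : ℕ)) 0 y γ'' := by rwa [← hend]
  have hb := h₄.exp_le_tsum_partitionBound ω
  rw [← hend, ENNReal.ofReal_le_iff_le_toReal (hω N)] at hb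
  have hlog := (Real.le_log_iff_exp_le ((Real.exp_pos _).trans_le hb)).2 hb
  have : (visits ω s t γ : ℝ) ≤ visits ω (-N) N γ'' := by exact_mod_cast hv
  rw [hk] at hlog
  linarith

theorem exp_maxGain_le_tsum_partitionBound {n : ℕ} {ω : Config}
    (hS : ∑' b : ℤ, partitionBound 0 ω n b ≠ ∞) :
    maxGain 0 n ω ≠ ∞ ∧ ENNReal.ofReal (Real.exp (maxGain 0 n ω).toReal) ≤
      ∑' b : ℤ, partitionBound 0 ω n b := by
  set S := ∑' b : ℤ, partitionBound 0 ω n b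
  have hb : ∀ γ, IsPath 0 n 0 0 γ →
      Real.exp (visits ω 0 n γ - kineticAction 0 n γ / 2) ≤ S.toReal := by
    intro γ hγ
    have h1 : IsPath 0 (0 + n) 0 0 γ := by rwa [zero_add]
    have := h1.exp_le_tsum_partitionBound ω
    rwa [zero_add, ENNReal.ofReal_le_iff_le_toReal hS] at this
  have h0 : 1 ≤ S.toReal := by
    obtain ⟨h1, h2⟩ := isPath_affine (Nat.cast_nonneg (α := ℝ) n) 0 0
    have := hb _ (by simpa using h1)
    simp only [zero_mul, add_zero, sub_zero] at h2
    refine le_trans (Real.one_le_exp ?_) this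
    simp [h2]
  -- The gain charges the full action, so it is below the exponent in the bound, which charges half.
  have hle : maxGain 0 n ω ≤ ENNReal.ofReal (Real.log S.toReal) := by
    refine iSup₂_le fun γ hγ => ENNReal.ofReal_le_ofReal ?_
    rw [Real.le_log_iff_exp_le (by linarith)]
    refine le_trans (Real.exp_le_exp.2 ?_) (hb γ hγ)
    linarith [kineticAction_nonneg (Nat.cast_nonneg (α := ℝ) n) γ]
  refine ⟨ne_top_of_le_ne_top ENNReal.ofReal_ne_top hle, ?_⟩
  rw [ENNReal.ofReal_le_iff_le_toReal hS, ← Real.le_log_iff_exp_le (by linarith)]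
  exact ENNReal.toReal_le_of_le_ofReal (Real.log_nonneg h0) hle

/-! ### A law of large numbers for superadditive processes with independent increments. -/

/-- Choose `n` with `t / 2^n` in `[m, 2m)`. Then `t` lies between `j 2^n` and `(j + 1) 2^n` for some
`j` in `[m, 2m)`, a relative gap of at most `1 / m`, and monotonicity interpolates. Only finitely
many `j` occur, so convergence is uniform in them. -/
theorem tendsto_div_of_tendsto_dyadic {f : ℝ → ℝ} {z : ℝ} (h0 : ∀ t, 0 ≤ f t)
    (hmono : ∀ s t, 0 ≤ s → s ≤ t → f s ≤ f t)
    (h : ∀ m : ℕ, 1 ≤ m →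
      Tendsto (fun n : ℕ => f (m * 2 ^ n) / (m * 2 ^ n)) atTop (𝓝 z)) :
    Tendsto (fun t => f t / t) atTop (𝓝 z) := by
  have hz : 0 ≤ z := ge_of_tendsto' (h 1 le_rfl) fun n => div_nonneg (h0 _) (by positivity)
  rw [Metric.tendsto_atTop]
  intro ε hε
  obtain ⟨m, hm⟩ := exists_nat_gt (2 * (z + ε) / ε)
  have hm0 : (0 : ℝ) < m := lt_of_le_of_lt (by positivity) hm
  have hm1 : 1 ≤ m := by exact_mod_cast hm0
  have hmε : (z + ε) / m < ε / 2 := by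
    rw [div_lt_iff₀ hε] at hm
    rw [div_lt_iff₀ hm0]
    linarith
  have hev : ∀ᶠ n : ℕ in atTop, ∀ j ∈ Finset.Icc m (2 * m),
      dist (f (j * 2 ^ n) / (j * 2 ^ n)) z < ε / 2 := by
    rw [Finset.eventually_all]
    intro j hj
    exact (h j (hm1.trans (Finset.mem_Icc.1 hj).1)).eventually (Metric.ball_mem_nhds z (by positivity))
  obtain ⟨N, hN⟩ := eventually_atTop.1 hev
  refine ⟨m * 2 ^ N, fun t ht => ?_⟩
  have h2N : (1 : ℝ) ≤ 2 ^ N := one_le_pow₀ (by norm_num)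
  have htm : (2 : ℝ) ^ N ≤ t / m := by rw [le_div_iff₀ hm0]; linarith
  obtain ⟨n, hn1, hn2⟩ := exists_nat_pow_near (h2N.trans htm) (one_lt_two : (1 : ℝ) < 2)
  have hnN : N ≤ n := by
    have : (2 : ℝ) ^ N < 2 ^ (n + 1) := htm.trans_lt hn2
    have := (pow_lt_pow_iff_right₀ (one_lt_two : (1 : ℝ) < 2)).1 this
    omega
  have hp : (0 : ℝ) < 2 ^ n := by positivity
  have ht0 : 0 < t := lt_of_lt_of_le (by positivity) ht
  rw [le_div_iff₀ hm0] at hn1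
  rw [div_lt_iff₀ hm0, pow_succ] at hn2
  set j := ⌊t / 2 ^ n⌋₊
  have hj1 : (j : ℝ) * 2 ^ n ≤ t := by
    rw [← le_div_iff₀ hp]; exact Nat.floor_le (by positivity)
  have hj2 : t < (j + 1) * 2 ^ n := by
    rw [← div_lt_iff₀ hp]; exact Nat.lt_floor_add_one _
  have hjm : m ≤ j := Nat.le_floor (by rw [le_div_iff₀ hp]; linarith)
  have hj2m : j < 2 * m := by
    rw [Nat.floor_lt (by positivity), div_lt_iff₀ hp]; push_cast; linarith
  have hA := abs_lt.1 (hN n hnN j (Finset.mem_Icc.2 ⟨hjm, hj2m.le⟩))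
  have hB := abs_lt.1 (hN n hnN (j + 1) (Finset.mem_Icc.2 ⟨by omega, by omega⟩))
  have hj0 : (0 : ℝ) < j := by exact_mod_cast (hm1.trans hjm)
  have hL : (z - ε / 2) * (j * 2 ^ n) < f (j * 2 ^ n) := by
    rw [← lt_div_iff₀ (by positivity)]; linarith [hA.1]
  have hU : f ((j + 1 : ℕ) * 2 ^ n) < (z + ε / 2) * ((j + 1 : ℕ) * 2 ^ n) := by
    rw [← div_lt_iff₀ (by positivity)]; linarith [hB.2]
  push_cast at hU
  have hm2 : (2 : ℝ) ^ n ≤ t / m := by rw [le_div_iff₀ hm0]; linarith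
  have e1 := hmono _ _ (by positivity) hj1
  have e2 := hmono _ _ ht0.le hj2.le
  have hzm : z * (t / m) ≤ (z + ε) / m * t := by
    rw [div_mul_eq_mul_div, mul_div_assoc']
    gcongr; linarith
  have hzm' : (z + ε / 2) * (t / m) ≤ (z + ε) / m * t := by
    rw [div_mul_eq_mul_div, mul_div_assoc']
    gcongr; linarith
  have hlt : (z + ε) / m * t < ε / 2 * t := mul_lt_mul_of_pos_right hmε ht0
  rw [Real.dist_eq, abs_lt]
  constructor
  · rw [lt_sub_iff_add_lt, lt_div_iff₀ ht0]
    have : z * (t - 2 ^ n) ≤ z * (j * 2 ^ n) := mul_le_mul_of_nonneg_left (by linarith) hz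
    have : z * 2 ^ n ≤ z * (t / m) := mul_le_mul_of_nonneg_left hm2 hz
    have : ε / 2 * (j * 2 ^ n) ≤ ε / 2 * t := mul_le_mul_of_nonneg_left hj1 (by positivity)
    linarith
  · rw [sub_lt_iff_lt_add, div_lt_iff₀ ht0]
    have : (z + ε / 2) * ((j + 1) * 2 ^ n) ≤ (z + ε / 2) * (t + t / m) :=
      mul_le_mul_of_nonneg_left (by linarith) (by positivity)
    linarith

theorem ae_tendsto_zero_of_summable_integral {Ω : Type*} [MeasurableSpace Ω] {P : Measure Ω}
    {f : ℕ → Ω → ℝ} (h0 : ∀ n ω, 0 ≤ f n ω) (hi : ∀ n, Integrable (f n) P)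
    (hs : Summable fun n => ∫ ω, f n ω ∂P) :
    ∀ᵐ ω ∂P, Tendsto (fun n => f n ω) atTop (𝓝 0) := by
  have hm : ∀ n, AEMeasurable (fun ω => ENNReal.ofReal (f n ω)) P :=
    fun n => (hi n).aemeasurable.ennreal_ofReal
  have hfin : ∫⁻ ω, ∑' n, ENNReal.ofReal (f n ω) ∂P ≠ ∞ := by
    rw [lintegral_tsum hm]
    simp_rw [← ofReal_integral_eq_lintegral_ofReal (hi _) (.of_forall (h0 _))]
    rw [← ENNReal.ofReal_tsum_of_nonneg (fun n => integral_nonneg (h0 n)) hs]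
    exact ENNReal.ofReal_ne_top
  filter_upwards [ae_lt_top' (AEMeasurable.tsum hm) hfin] with ω hω
  have h1 := ENNReal.tendsto_atTop_zero_of_tsum_ne_top hω.ne
  have h2 := (ENNReal.tendsto_toReal ENNReal.zero_ne_top).comp h1
  simpa [Function.comp_def, ENNReal.toReal_ofReal (h0 _ _)] using h2

/-- A nonnegative process, nondecreasing in time, which is superadditive with respect to
independent copies of its increments and has exponential moments. -/
structure IsSuperadditiveProcess {Ω : Type*} [MeasurableSpace Ω] (P : Measure Ω)
    (Z : ℝ → Ω → ℝ) : Prop where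
  measurable : ∀ t, 0 ≤ t → Measurable (Z t)
  nonneg : ∀ t ω, 0 ≤ Z t ω
  zero : ∀ ω, Z 0 ω = 0
  mono : ∀ᵐ ω ∂P, ∀ s t, 0 ≤ s → s ≤ t → Z s ω ≤ Z t ω
  superadd : ∀ s t, 0 < s → 0 < t → ∃ Z' : Ω → ℝ, IdentDistrib Z' (Z t) P P ∧
    IndepFun (Z s) Z' P ∧ ∀ᵐ ω ∂P, Z s ω + Z' ω ≤ Z (s + t) ω
  exp_bound : ∃ κ : ℝ, 0 ≤ κ ∧ ∀ n : ℕ,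
    ∫⁻ ω, ENNReal.ofReal (Real.exp (Z n ω)) ∂P ≤ ENNReal.ofReal (Real.exp (κ * n))

namespace IsSuperadditiveProcess

variable {Ω : Type*} [MeasurableSpace Ω] {P : Measure Ω} {Z : ℝ → Ω → ℝ}

/-- Normalized so that `1 + x ≤ exp x` yields `𝔼 Z_n ≤ K n`, and likewise `𝔼 (Z_n - K n)⁺ ≤ 1`. -/
theorem exists_integral_exp_le (h : IsSuperadditiveProcess P Z) : ∃ K : ℝ, 0 ≤ K ∧ ∀ n : ℕ,
    Integrable (fun ω => Real.exp (Z n ω - K * n)) P ∧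
      ∫ ω, Real.exp (Z n ω - K * n) ∂P ≤ 1 := by
  obtain ⟨κ, hκ, hb⟩ := h.exp_bound
  refine ⟨κ, hκ, fun n => ?_⟩
  have hm : Measurable fun ω => Real.exp (Z n ω) :=
    Real.measurable_exp.comp (h.measurable n (Nat.cast_nonneg n))
  have hi : Integrable (fun ω => Real.exp (Z n ω)) P := by
    refine ⟨hm.aestronglyMeasurable, ?_⟩
    rw [hasFiniteIntegral_iff_ofReal (.of_forall fun _ => Real.exp_nonneg _)]
    exact (hb n).trans_lt ENNReal.ofReal_lt_top
  have e : (fun ω => Real.exp (Z n ω - κ * n)) =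
      fun ω => Real.exp (Z n ω) * (Real.exp (κ * n))⁻¹ := by
    ext ω; rw [Real.exp_sub, div_eq_mul_inv]
  rw [e]
  refine ⟨hi.mul_const _, ?_⟩
  rw [integral_mul_const, mul_inv_le_iff₀ (Real.exp_pos _), one_mul,
    integral_eq_lintegral_of_nonneg_ae (.of_forall fun _ => Real.exp_nonneg _)
      hm.aestronglyMeasurable]
  exact ENNReal.toReal_le_of_le_ofReal (Real.exp_nonneg _) (hb n)

variable [IsProbabilityMeasure P]

theorem integrable (h : IsSuperadditiveProcess P Z) {t : ℝ} (ht : 0 ≤ t) : Integrable (Z t) P := by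
  obtain ⟨K, hK, hb⟩ := h.exists_integral_exp_le
  refine ((hb ⌈t⌉₊).1.add (integrable_const (K * ⌈t⌉₊))).mono'
    (h.measurable t ht).aestronglyMeasurable ?_
  filter_upwards [h.mono] with ω hω
  rw [Real.norm_of_nonneg (h.nonneg t ω)]
  have h1 := hω t ⌈t⌉₊ ht (Nat.le_ceil t)
  have h2 := Real.add_one_le_exp (Z ⌈t⌉₊ ω - K * ⌈t⌉₊)
  simp only [Pi.add_apply]
  linarith

theorem integral_mono (h : IsSuperadditiveProcess P Z) {s t : ℝ} (hs : 0 ≤ s) (hst : s ≤ t) :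
    ∫ ω, Z s ω ∂P ≤ ∫ ω, Z t ω ∂P :=
  integral_mono_ae (h.integrable hs) (h.integrable (hs.trans hst)) <| by
    filter_upwards [h.mono] with ω hω using hω s t hs hst

theorem integral_superadd (h : IsSuperadditiveProcess P Z) {s t : ℝ} (hs : 0 ≤ s) (ht : 0 ≤ t) :
    ∫ ω, Z s ω ∂P + ∫ ω, Z t ω ∂P ≤ ∫ ω, Z (s + t) ω ∂P := by
  rcases hs.eq_or_lt with rfl | hs'
  · simp [h.zero]
  rcases ht.eq_or_lt with rfl | ht'
  · simp [h.zero]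
  obtain ⟨Z', hid, -, hle⟩ := h.superadd s t hs' ht'
  have hi : Integrable Z' P := hid.integrable_iff.2 (h.integrable ht)
  rw [← hid.integral_eq, ← integral_add (h.integrable hs) hi]
  exact integral_mono_ae ((h.integrable hs).add hi) (h.integrable (add_nonneg hs ht)) hle

theorem nsmul_integral_le (h : IsSuperadditiveProcess P Z) {t : ℝ} (ht : 0 ≤ t) (n : ℕ) :
    n * ∫ ω, Z t ω ∂P ≤ ∫ ω, Z (n * t) ω ∂P := by
  induction n with
  | zero => simp [h.zero]
  | succ k ih =>
    have := h.integral_superadd (mul_nonneg (Nat.cast_nonneg k) ht) ht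
    push_cast
    rw [add_mul, one_mul, add_mul, one_mul]
    linarith

/-- Fekete's lemma for `-𝔼 Z_n` at integer times; monotonicity of the means handles real times. -/
theorem exists_limit (h : IsSuperadditiveProcess P Z) : ∃ z : ℝ, 0 ≤ z ∧
    (∀ t, 0 ≤ t → ∫ ω, Z t ω ∂P ≤ z * t) ∧
    Tendsto (fun t => (∫ ω, Z t ω ∂P) / t) atTop (𝓝 z) := by
  obtain ⟨K, hK, hb⟩ := h.exists_integral_exp_le
  let u : ℕ → ℝ := fun n => -∫ ω, Z n ω ∂P
  have hu : Subadditive u := by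
    intro m n
    have := h.integral_superadd (Nat.cast_nonneg (α := ℝ) m) (Nat.cast_nonneg n)
    simp only [u]
    push_cast
    linarith
  have hint : ∀ n : ℕ, ∫ ω, Z n ω ∂P ≤ K * n := by
    intro n
    have h1 : ∫ ω, Z n ω ∂P ≤ ∫ ω, (Real.exp (Z n ω - K * n) + (K * n - 1)) ∂P := by
      refine MeasureTheory.integral_mono (h.integrable (Nat.cast_nonneg n))
        ((hb n).1.add (integrable_const _)) fun ω => ?_
      have h2 := Real.add_one_le_exp (Z n ω - K * n)
      simp only
      linarith
    rw [integral_add (hb n).1 (integrable_const _)] at h1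
    simp only [integral_const, probReal_univ, smul_eq_mul, one_mul] at h1
    linarith [(hb n).2]
  have hbdd : BddBelow (Set.range fun n => u n / n) := by
    refine ⟨-K, ?_⟩
    rintro _ ⟨n, rfl⟩
    rcases Nat.eq_zero_or_pos n with rfl | hn
    · simpa using hK
    · have hn' : (0 : ℝ) < n := by exact_mod_cast hn
      simp only [u]
      rw [le_div_iff₀ hn']
      linarith [hint n]
  set z := -hu.lim with hz
  have hlim : Tendsto (fun n : ℕ => (∫ ω, Z n ω ∂P) / n) atTop (𝓝 z) := by
    have := (hu.tendsto_lim hbdd).neg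
    simpa [u, neg_div] using this
  have hle : ∀ n : ℕ, ∫ ω, Z n ω ∂P ≤ z * n := by
    intro n
    rcases Nat.eq_zero_or_pos n with rfl | hn
    · simp [h.zero]
    · have hn' : (0 : ℝ) < n := by exact_mod_cast hn
      have := hu.lim_le_div hbdd hn.ne'
      rw [le_div_iff₀ hn'] at this
      simp only [u] at this
      rw [hz]; linarith
  have hz0 : 0 ≤ z := by
    have := hle 1
    have h1 : 0 ≤ ∫ ω, Z (1 : ℕ) ω ∂P := integral_nonneg (h.nonneg _)
    push_cast at this h1
    linarith
  have hler : ∀ t, 0 ≤ t → ∫ ω, Z t ω ∂P ≤ z * t := by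
    intro t ht
    -- Rounding `n t` up to an integer costs at most `z`, which is negligible after division by `n`.
    have h1 : ∀ n : ℕ, 1 ≤ n → ∫ ω, Z t ω ∂P ≤ z * t + z / n := by
      intro n hn
      have hn' : (0 : ℝ) < n := by exact_mod_cast hn
      have h2 := h.nsmul_integral_le ht n
      have hnt : 0 ≤ n * t := mul_nonneg hn'.le ht
      have h3 := h.integral_mono hnt (Nat.le_ceil _)
      have h4 := hle ⌈(n : ℝ) * t⌉₊
      have h5 : z * ⌈(n : ℝ) * t⌉₊ ≤ z * (n * t + 1) :=
        mul_le_mul_of_nonneg_left (Nat.ceil_lt_add_one hnt).le hz0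
      rw [← mul_le_mul_iff_right₀ hn', mul_add, mul_div_cancel₀ _ hn'.ne']
      linarith
    have h6 : Tendsto (fun n : ℕ => z * t + z / n) atTop (𝓝 (z * t + 0)) :=
      tendsto_const_nhds.add (tendsto_const_div_atTop_nhds_zero_nat z)
    rw [add_zero] at h6
    exact ge_of_tendsto h6 (eventually_atTop.2 ⟨1, h1⟩)
  refine ⟨z, hz0, hler, ?_⟩
  have hfl := (hlim.comp (tendsto_nat_floor_atTop (α := ℝ))).mul (tendsto_nat_floor_div_atTop (R := ℝ))
  rw [mul_one] at hfl
  refine tendsto_of_tendsto_of_tendsto_of_le_of_le' hfl tendsto_const_nhds ?_ ?_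
  · filter_upwards [eventually_ge_atTop (1 : ℝ)] with t ht
    have ht0 : 0 < t := by linarith
    have hf : (0 : ℝ) < ⌊t⌋₊ := by exact_mod_cast Nat.floor_pos.2 ht
    simp only [Function.comp_apply]
    rw [div_mul_div_cancel₀ hf.ne']
    exact div_le_div_of_nonneg_right (h.integral_mono hf.le (Nat.floor_le ht0.le)) ht0.le
  · filter_upwards [eventually_gt_atTop (0 : ℝ)] with t ht
    rw [div_le_iff₀ ht]
    exact hler t ht.le

/-- Write `Z / t_n = K - w_n + r_n` with `w_n` and `r_n` the negative and positive parts of `Z / t_n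
- K`. The remainder has mean at most `1 / t_n`, which is summable. Since `w_n` takes values in `[0,
K]` and `w_{n+1} ≤ (w_n + w'_n) / 2` with an independent copy `w'_n`, squaring gives `q_{n+1} ≤ (q_n
+ u_n²) / 2` for the second moments `q_n` and means `u_n`. Hence the variance `q_n - u_n²` is at
most `2 (q_n - q_{n+1})`, and the variances are summable. -/
theorem ae_tendsto_dyadic (h : IsSuperadditiveProcess P Z) {z : ℝ}
    (hz : Tendsto (fun t => (∫ ω, Z t ω ∂P) / t) atTop (𝓝 z)) {m : ℕ} (hm : 1 ≤ m) :
    ∀ᵐ ω ∂P, Tendsto (fun n : ℕ => Z (m * 2 ^ n) ω / (m * 2 ^ n)) atTop (𝓝 z) := by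
  obtain ⟨K, hK, hb⟩ := h.exists_integral_exp_le
  have hm0 : (0 : ℝ) < m := by exact_mod_cast hm
  let t : ℕ → ℝ := fun n => m * 2 ^ n
  have ht0 : ∀ n, 0 < t n := fun n => by positivity
  have hcast : ∀ n, t n = ((m * 2 ^ n : ℕ) : ℝ) := fun n => by simp [t]
  have htt : Tendsto t atTop atTop :=
    (tendsto_pow_atTop_atTop_of_one_lt (one_lt_two : (1 : ℝ) < 2)).const_mul_atTop hm0
  let φ : ℕ → ℝ → ℝ := fun n x => max (K - x / t n) 0
  have hφm : ∀ n, Measurable (φ n) := fun n => by fun_prop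
  let w : ℕ → Ω → ℝ := fun n ω => φ n (Z (t n) ω)
  let r : ℕ → Ω → ℝ := fun n ω => max (Z (t n) ω / t n - K) 0
  have hZm : ∀ n, Measurable (Z (t n)) := fun n => h.measurable _ (ht0 n).le
  have hZi : ∀ n, Integrable (Z (t n)) P := fun n => h.integrable (ht0 n).le
  have hwm : ∀ n, Measurable (w n) := fun n => (hφm n).comp (hZm n)
  have hw0 : ∀ n ω, 0 ≤ w n ω := fun n ω => le_max_right _ _
  have hwK : ∀ n ω, w n ω ≤ K := fun n ω =>
    max_le (by linarith [div_nonneg (h.nonneg (t n) ω) (ht0 n).le]) hK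
  have hwi : ∀ n, Integrable (w n) P := fun n =>
    Integrable.of_bound (hwm n).aestronglyMeasurable K
      (.of_forall fun ω => by rw [Real.norm_of_nonneg (hw0 n ω)]; exact hwK n ω)
  have hwi2 : ∀ n, Integrable (fun ω => w n ω ^ 2) P := fun n =>
    Integrable.of_bound ((hwm n).pow_const 2).aestronglyMeasurable (K ^ 2)
      (.of_forall fun ω => by
        rw [Real.norm_of_nonneg (sq_nonneg _)]
        exact pow_le_pow_left₀ (hw0 n ω) (hwK n ω) 2)
  have hri : ∀ n, Integrable (r n) P := fun n =>
    (((hZi n).div_const _).sub (integrable_const K)).pos_part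
  let u : ℕ → ℝ := fun n => ∫ ω, w n ω ∂P
  let q : ℕ → ℝ := fun n => ∫ ω, w n ω ^ 2 ∂P
  have hr_le : ∀ n, ∫ ω, r n ω ∂P ≤ 1 / t n := by
    intro n
    have hbn := hb (m * 2 ^ n)
    rw [← hcast] at hbn
    rw [le_div_iff₀ (ht0 n), ← integral_mul_const]
    refine le_trans (MeasureTheory.integral_mono ((hri n).mul_const _) hbn.1 fun ω => ?_) hbn.2
    simp only [r]
    rw [max_mul_of_nonneg _ _ (ht0 n).le, sub_mul, div_mul_cancel₀ _ (ht0 n).ne', zero_mul]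
    exact max_le (by linarith [Real.add_one_le_exp (Z (t n) ω - K * t n)]) (Real.exp_nonneg _)
  have hdecomp : ∀ n ω, Z (t n) ω / t n = K - w n ω + r n ω := by
    intro n ω
    simp only [w, φ, r]
    rcases le_total (K - Z (t n) ω / t n) 0 with h1 | h1
    · rw [max_eq_right h1, max_eq_left (by linarith)]; ring
    · rw [max_eq_left h1, max_eq_right (by linarith)]; ring
  have hinv : Tendsto (fun n => 1 / t n) atTop (𝓝 0) := by
    simp_rw [one_div]; exact htt.inv_tendsto_atTop
  have hr_lim : Tendsto (fun n => ∫ ω, r n ω ∂P) atTop (𝓝 0) :=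
    squeeze_zero (fun n => integral_nonneg fun ω => le_max_right _ _) hr_le hinv
  have hu_lim : Tendsto u atTop (𝓝 (K - z)) := by
    have e : u = fun n => K - (∫ ω, Z (t n) ω ∂P) / t n + ∫ ω, r n ω ∂P := by
      ext n
      have hKw : Integrable (fun ω => K - w n ω) P := (integrable_const K).sub (hwi n)
      have hsum : (∫ ω, Z (t n) ω ∂P) / t n = K - u n + ∫ ω, r n ω ∂P := by
        rw [← integral_div, integral_congr_ae (.of_forall (hdecomp n)), integral_add hKw (hri n),
          integral_sub (integrable_const K) (hwi n)]
        simp [u]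
      rw [hsum]; ring
    rw [e]
    simpa using (tendsto_const_nhds.sub (hz.comp htt)).add hr_lim
  have hq : ∀ n, ∫ ω, (w n ω - u n) ^ 2 ∂P ≤ 2 * (q n - q (n + 1)) := by
    intro n
    have htn : t (n + 1) = t n + t n := by simp only [t]; ring
    obtain ⟨Z', hid, hind, hle⟩ := h.superadd (t n) (t n) (ht0 n) (ht0 n)
    let w' : Ω → ℝ := fun ω => φ n (Z' ω)
    have hidw : IdentDistrib w' (w n) P P := hid.comp (hφm n)
    have hidw2 : IdentDistrib (fun ω => w' ω ^ 2) (fun ω => w n ω ^ 2) P P :=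
      hidw.comp (u := fun x : ℝ => x ^ 2) (by fun_prop)
    have hindw : IndepFun (w n) w' P := hind.comp (hφm n) (hφm n)
    have hi' : Integrable w' P := hidw.integrable_iff.2 (hwi n)
    have hi2' : Integrable (fun ω => w' ω ^ 2) P := hidw2.integrable_iff.2 (hwi2 n)
    have hprod : Integrable (fun ω => w n ω * w' ω) P := hindw.integrable_mul (hwi n) hi'
    have hprod_eq : ∫ ω, w n ω * w' ω ∂P = u n * u n := by
      have := hindw.integral_mul_eq_mul_integral (hwm n).aestronglyMeasurable
        hi'.aestronglyMeasurable
      rw [hidw.integral_eq] at this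
      exact this
    have hq1 : q (n + 1) ≤ ∫ ω, ((w n ω ^ 2 / 4 + w' ω ^ 2 / 4) + (w n ω * w' ω) / 2) ∂P := by
      refine integral_mono_ae (hwi2 (n + 1))
        ((((hwi2 n).div_const 4).add (hi2'.div_const 4)).add (hprod.div_const 2)) ?_
      filter_upwards [hle] with ω hω
      -- Superadditivity over the doubled time, then convexity of the positive part.
      have h1 : w (n + 1) ω ≤ (w n ω + w' ω) / 2 := by
        have a1 : K - Z (t n) ω / t n ≤ w n ω := le_max_left _ _
        have a2 : K - Z' ω / t n ≤ w' ω := le_max_left _ _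
        have a3 : 0 ≤ w' ω := le_max_right _ _
        refine max_le ?_ (by linarith [hw0 n ω])
        rw [← htn] at hω
        have a4 : (Z (t n) ω + Z' ω) / t (n + 1) ≤ Z (t (n + 1)) ω / t (n + 1) :=
          div_le_div_of_nonneg_right hω (ht0 _).le
        have a5 : (Z (t n) ω + Z' ω) / t (n + 1) = (Z (t n) ω / t n + Z' ω / t n) / 2 := by
          have := (ht0 n).ne'
          rw [htn]; field_simp; ring
        linarith
      have h2 := pow_le_pow_left₀ (hw0 (n + 1) ω) h1 2
      linarith
    have hs4 : Integrable (fun ω => w n ω ^ 2 / 4 + w' ω ^ 2 / 4) P :=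
      ((hwi2 n).div_const 4).add (hi2'.div_const 4)
    rw [integral_add hs4 (hprod.div_const 2),
      integral_add ((hwi2 n).div_const 4) (hi2'.div_const 4), integral_div, integral_div,
      integral_div, hprod_eq, hidw2.integral_eq] at hq1
    have hvar : ∫ ω, (w n ω - u n) ^ 2 ∂P = q n - u n * u n := by
      have e : (fun ω => (w n ω - u n) ^ 2) =
          fun ω => (w n ω ^ 2 - 2 * u n * w n ω) + u n ^ 2 := by ext ω; ring
      have hs2 : Integrable (fun ω => w n ω ^ 2 - 2 * u n * w n ω) P :=
        (hwi2 n).sub ((hwi n).const_mul _)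
      rw [e, integral_add hs2 (integrable_const _),
        integral_sub (hwi2 n) ((hwi n).const_mul _), integral_const_mul]
      simp only [integral_const, probReal_univ, smul_eq_mul, one_mul, q, u]
      ring
    rw [hvar]
    simp only [q] at hq1 ⊢
    linarith
  have hq0 : ∀ n, 0 ≤ q n := fun n => integral_nonneg fun ω => sq_nonneg _
  have hsumV : Summable fun n => ∫ ω, (w n ω - u n) ^ 2 ∂P := by
    refine summable_of_sum_range_le (c := 2 * q 0) (fun n => integral_nonneg fun ω => sq_nonneg _)
      fun n => ?_
    refine (Finset.sum_le_sum fun i _ => hq i).trans ?_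
    rw [← Finset.mul_sum, Finset.sum_range_sub']
    linarith [hq0 n]
  have hsumr : Summable fun n => ∫ ω, r n ω ∂P := by
    refine Summable.of_nonneg_of_le (fun n => integral_nonneg fun ω => le_max_right _ _)
      hr_le ?_
    have : (fun n => 1 / t n) = fun n => (1 / (m : ℝ)) * (1 / 2) ^ n := by
      ext n; simp only [t]; rw [one_div_pow, one_div_mul_one_div]
    rw [this]
    exact summable_geometric_two.mul_left _
  have hVi : ∀ n, Integrable (fun ω => (w n ω - u n) ^ 2) P := by
    intro n
    have e : (fun ω => (w n ω - u n) ^ 2) =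
        fun ω => (w n ω ^ 2 - 2 * u n * w n ω) + u n ^ 2 := by ext ω; ring
    rw [e]
    exact ((hwi2 n).sub ((hwi n).const_mul _)).add (integrable_const _)
  filter_upwards [ae_tendsto_zero_of_summable_integral (fun n ω => sq_nonneg _) hVi hsumV,
    ae_tendsto_zero_of_summable_integral (fun n ω => le_max_right _ _) hri hsumr] with ω h1 h2
  have h3 : Tendsto (fun n => w n ω - u n) atTop (𝓝 0) := by
    have := h1.sqrt
    rw [Real.sqrt_zero] at this
    simp_rw [Real.sqrt_sq_eq_abs] at this
    exact (tendsto_zero_iff_abs_tendsto_zero _).2 this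
  have h4 := ((tendsto_const_nhds (x := K)).sub (h3.add hu_lim)).add h2
  simp only [sub_add_cancel, zero_add, sub_sub_cancel, add_zero] at h4
  refine h4.congr fun n => ?_
  rw [← hdecomp n ω]

theorem ae_tendsto (h : IsSuperadditiveProcess P Z) {z : ℝ}
    (hz : Tendsto (fun t => (∫ ω, Z t ω ∂P) / t) atTop (𝓝 z)) :
    ∀ᵐ ω ∂P, Tendsto (fun t => Z t ω / t) atTop (𝓝 z) := by
  have h1 : ∀ᵐ ω ∂P, ∀ m : ℕ, 1 ≤ m →
      Tendsto (fun n : ℕ => Z (m * 2 ^ n) ω / (m * 2 ^ n)) atTop (𝓝 z) := by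
    rw [ae_all_iff]
    intro m
    by_cases hm : 1 ≤ m
    · filter_upwards [h.ae_tendsto_dyadic hz hm] with ω hω _ using hω
    · exact .of_forall fun ω h' => absurd h' hm
  filter_upwards [h1, h.mono] with ω h1 h2
  exact tendsto_div_of_tendsto_dyadic (fun t => h.nonneg t ω) h2 h1

/-- Scheffé's argument: `|x - z| = 2 (z - x)⁺ + (x - z)`. The first term is dominated by `z` because
`Z ≥ 0`, and the mean of the second tends to `0` by `hz`. -/
theorem tendsto_integral_abs (h : IsSuperadditiveProcess P Z) {z : ℝ} (hz0 : 0 ≤ z)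
    (hz : Tendsto (fun t => (∫ ω, Z t ω ∂P) / t) atTop (𝓝 z)) :
    Tendsto (fun t => ∫ ω, |Z t ω / t - z| ∂P) atTop (𝓝 0) := by
  have h1 : Tendsto (fun t => ∫ ω, max (z - Z t ω / t) 0 ∂P) atTop (𝓝 (∫ _, (0 : ℝ) ∂P)) := by
    refine tendsto_integral_filter_of_dominated_convergence (fun _ => z) ?_ ?_
      (integrable_const z) ?_
    · filter_upwards [eventually_ge_atTop (0 : ℝ)] with t ht
      exact (((h.measurable t ht).div_const t).const_sub z |>.max measurable_const).aestronglyMeasurable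
    · filter_upwards [eventually_ge_atTop (0 : ℝ)] with t ht
      refine .of_forall fun ω => ?_
      rw [Real.norm_of_nonneg (le_max_right _ _)]
      exact max_le (by linarith [div_nonneg (h.nonneg t ω) ht]) hz0
    · filter_upwards [h.ae_tendsto hz] with ω hω
      simpa using (hω.const_sub z).max (tendsto_const_nhds (x := (0 : ℝ)))
  rw [integral_zero] at h1
  have h2 := (h1.const_mul 2).add (hz.sub_const z)
  rw [mul_zero, sub_self, add_zero] at h2
  refine h2.congr' ?_
  filter_upwards [eventually_ge_atTop (0 : ℝ)] with t ht
  have hi : Integrable (fun ω => Z t ω / t) P := (h.integrable ht).div_const t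
  have hi2 : Integrable (fun ω => max (z - Z t ω / t) 0) P := ((integrable_const z).sub hi).pos_part
  have e : (fun ω => |Z t ω / t - z|) =
      fun ω => 2 * max (z - Z t ω / t) 0 + (Z t ω / t - z) := by
    ext ω
    rcases le_total (Z t ω / t - z) 0 with h3 | h3
    · rw [abs_of_nonpos h3, max_eq_left (by linarith)]; ring
    · rw [abs_of_nonneg h3, max_eq_right (by linarith)]; ring
  have hi3 : Integrable (fun ω => Z t ω / t - z) P := hi.sub (integrable_const z)
  rw [e, integral_add (hi2.const_mul 2) hi3, integral_const_mul,
    integral_sub hi (integrable_const z), integral_div]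
  simp

end IsSuperadditiveProcess

/-! ### The maximal gain: superadditivity, time shift and Galilean shear. -/

/-- Resting at `0` has no kinetic cost. Hence the truncation by `ENNReal.ofReal` in `maxGain` loses
nothing. -/
theorem IsPath.exists_nonneg_gain (ω : Config) {s t : ℝ} (hst : s ≤ t) {γ : ℝ → ℝ}
    (h : IsPath s t 0 0 γ) : ∃ γ', IsPath s t 0 0 γ' ∧
      0 ≤ (visits ω s t γ' : ℝ) - kineticAction s t γ' ∧
      (visits ω s t γ : ℝ) - kineticAction s t γ ≤ visits ω s t γ' - kineticAction s t γ' := by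
  by_cases h0 : 0 ≤ (visits ω s t γ : ℝ) - kineticAction s t γ
  · exact ⟨γ, h, h0, le_rfl⟩
  · obtain ⟨h1, h2⟩ := isPath_affine hst 0 0
    have h3 : (0 : ℝ) ≤ (visits ω s t fun u => 0 + 0 * (u - s) : ℕ) := Nat.cast_nonneg _
    refine ⟨fun u => 0 + 0 * (u - s), by simpa using h1, ?_, ?_⟩ <;> rw [h2] <;> linarith

theorem exists_isPath_zero {s t : ℝ} (hst : s ≤ t) : ∃ γ, IsPath s t 0 0 γ :=
  ⟨_, by simpa using (isPath_affine hst 0 0).1⟩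

theorem maxGain_add_le (ω : Config) {s r t : ℝ} (hsr : s ≤ r) (hrt : r ≤ t) :
    maxGain s r ω + maxGain r t ω ≤ maxGain s t ω := by
  refine ENNReal.biSup_add_biSup_le' (exists_isPath_zero hsr) (exists_isPath_zero hrt)
    fun γ₁ h₁ γ₂ h₂ => ?_
  obtain ⟨δ₁, k₁, p₁, l₁⟩ := h₁.exists_nonneg_gain ω hsr
  obtain ⟨δ₂, k₂, p₂, l₂⟩ := h₂.exists_nonneg_gain ω hrt
  obtain ⟨γ, hγ, e₁, e₂⟩ := k₁.glue hsr hrt k₂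
  refine (add_le_add (ENNReal.ofReal_le_ofReal l₁) (ENNReal.ofReal_le_ofReal l₂)).trans ?_
  rw [← ENNReal.ofReal_add p₁ p₂]
  refine le_iSup₂_of_le γ hγ (ENNReal.ofReal_le_ofReal (le_of_eq ?_))
  rw [visits_add ω hsr hrt (hγ.continuousOn (hsr.trans hrt)), hγ.kineticAction_add hsr hrt,
    k₁.kineticAction_congr hsr e₁, k₂.kineticAction_congr hrt e₂,
    visits_congr (ω := ω) (ω' := ω) (fun u hu => e₁ u ⟨hu.1, hu.2.le⟩) (fun _ _ => Iff.rfl),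
    visits_congr (ω := ω) (ω' := ω) (fun u hu => e₂ u ⟨hu.1, hu.2.le⟩) (fun _ _ => Iff.rfl)]
  push_cast
  ring

theorem maxGain_mono (ω : Config) {s t : ℝ} (hs : 0 ≤ s) (hst : s ≤ t) :
    maxGain 0 s ω ≤ maxGain 0 t ω :=
  le_self_add.trans (maxGain_add_le ω hs hst)

theorem maxGain_congr {ω ω' : Config} {s t : ℝ}
    (h : ∀ p : ℝ × ℝ, p.2 ∈ Set.Ico s t → (p ∈ ω'.points ↔ p ∈ ω.points)) :
    maxGain s t ω' = maxGain s t ω := by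
  unfold maxGain
  refine iSup_congr fun γ => iSup_congr fun _ => ?_
  rw [visits_congr (ω := ω) (ω' := ω') (fun _ _ => rfl) h]

theorem maxGain_self (s : ℝ) (ω : Config) : maxGain s s ω = 0 := by
  simp [maxGain, visits, kineticAction, Config.count]

/-- Shift of time by `-s`. -/
noncomputable def timeShift (s : ℝ) : (ℝ × ℝ) ≃ₜ (ℝ × ℝ) := Homeomorph.addRight ((0, -s) : ℝ × ℝ)

theorem timeShift_apply (s : ℝ) (p : ℝ × ℝ) : timeShift s p = (p.1, p.2 - s) := by
  simp [timeShift, sub_eq_add_neg, Prod.ext_iff]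

theorem measurePreserving_timeShift (s : ℝ) :
    MeasurePreserving (timeShift s) volume volume :=
  measurePreserving_add_right volume ((0, -s) : ℝ × ℝ)

theorem maxGain_map_timeShift_le (ω : Config) (s : ℝ) {t : ℝ} (ht : 0 ≤ t) :
    maxGain 0 t (Config.map (timeShift s) ω) ≤ maxGain s (s + t) ω := by
  refine iSup₂_le fun γ hγ => ?_
  obtain ⟨h1, h2⟩ := hγ.comp_add ht (-s)
  have e1 : (0 : ℝ) - -s = s := by ring
  have e2 : t - -s = s + t := by ring
  rw [e1, e2] at h1 h2
  refine le_iSup₂_of_le _ h1 (ENNReal.ofReal_le_ofReal (le_of_eq ?_))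
  rw [h2]
  congr 2
  refine visits_comp_equiv (timeShift s).toEquiv (fun p => (Config.mem_points_map _ _ _).symm) ?_
  ext p
  simp only [Set.mem_image, Homeomorph.coe_toEquiv, timeShift_apply, exists_exists_and_eq_and]
  constructor
  · rintro ⟨u, hu, rfl⟩
    exact ⟨u - s, ⟨by linarith [hu.1], by linarith [hu.2]⟩, by simp [sub_eq_add_neg]⟩
  · rintro ⟨u, hu, rfl⟩
    exact ⟨u + s, ⟨by linarith [hu.1], by linarith [hu.2]⟩, by simp⟩

/-- Galilean shear of space-time with velocity `v`. -/
noncomputable def shear (v : ℝ) : (ℝ × ℝ) ≃ₜ (ℝ × ℝ) where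
  toFun p := (p.1 - v * p.2, p.2)
  invFun p := (p.1 + v * p.2, p.2)
  left_inv p := by simp
  right_inv p := by simp
  continuous_toFun := by fun_prop
  continuous_invFun := by fun_prop

theorem shear_apply (v : ℝ) (p : ℝ × ℝ) : shear v p = (p.1 - v * p.2, p.2) := rfl

theorem measurePreserving_shear (v : ℝ) : MeasurePreserving (shear v) volume volume := by
  -- With the coordinates swapped, the shear is a skew product acting by translation on each fibre.
  have h1 : MeasurePreserving (fun p : ℝ × ℝ => (p.1, p.2 - v * p.1))
      (volume.prod volume) (volume.prod volume) :=
    (MeasurePreserving.id volume).skew_product (g := fun r x => x - v * r) (by fun_prop)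
      (.of_forall fun r => (measurePreserving_sub_right volume (v * r)).map_eq)
  have h2 := (Measure.measurePreserving_swap (μ := (volume : Measure ℝ))
    (ν := (volume : Measure ℝ)))
  exact (h2.comp h1).comp h2

theorem visits_map_shear (ω : Config) (s t v : ℝ) (γ : ℝ → ℝ) :
    visits (Config.map (shear v) ω) s t (fun u => γ u - v * u) = visits ω s t γ := by
  refine visits_comp_equiv (shear v).toEquiv (fun p => (Config.mem_points_map _ _ _).symm) ?_
  ext p
  simp only [Set.mem_image, Homeomorph.coe_toEquiv, shear_apply, exists_exists_and_eq_and]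

/-- Subtracting `v u` is a bijection of paths that preserves visits. The cross term in the action
depends only on the endpoints, so all actions shift by the same constant. -/
theorem isLeast_pathActions_map_shear {ω : Config} {t v A : ℝ} (ht : 0 ≤ t)
    (h : IsLeast (pathActions ω 0 t 0 (v * t)) A) :
    IsLeast (pathActions (Config.map (shear v) ω) 0 t 0 0) (A - v ^ 2 / 2 * t) := by
  constructor
  · obtain ⟨γ, hγ, hA⟩ := h.1
    obtain ⟨h1, h2⟩ := hγ.add_linear ht (-v)
    have e : (fun u => γ u + -v * u) = fun u => γ u - v * u := by ext u; ring
    rw [e] at h1 h2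
    refine ⟨fun u => γ u - v * u, by convert h1 using 1 <;> ring, ?_⟩
    rw [visits_map_shear, h2, hA]
    ring
  · rintro _ ⟨γ, hγ, rfl⟩
    obtain ⟨h1, h2⟩ := hγ.add_linear ht v
    have h3 := h.2 ⟨_, by convert h1 using 1 <;> ring, rfl⟩
    have h4 := visits_map_shear ω 0 t v (fun u => γ u + v * u)
    simp only [add_sub_cancel_right] at h4
    rw [h2, ← h4] at h3
    linarith

theorem eq_neg_toReal_maxGain {ω : Config} {t A : ℝ} (ht : 0 ≤ t)
    (h : IsLeast (pathActions ω 0 t 0 0) A) : A = -(maxGain 0 t ω).toReal := by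
  obtain ⟨γ, hγ, hA⟩ := h.1
  have h0 : 0 ≤ -A := by
    obtain ⟨γ', hγ', hp, -⟩ := hγ.exists_nonneg_gain ω ht
    have := h.2 ⟨γ', hγ', rfl⟩
    linarith
  have : maxGain 0 t ω = ENNReal.ofReal (-A) := by
    apply le_antisymm
    · refine iSup₂_le fun γ' hγ' => ENNReal.ofReal_le_ofReal ?_
      have := h.2 ⟨γ', hγ', rfl⟩
      linarith
    · exact le_iSup₂_of_le γ hγ (ENNReal.ofReal_le_ofReal (by rw [hA]; linarith))
  rw [this, ENNReal.toReal_ofReal h0, neg_neg]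

theorem isLeast_pathActions_self (ω : Config) (s x : ℝ) : IsLeast (pathActions ω s s x x) 0 := by
  have h : ∀ γ, kineticAction s s γ - (visits ω s s γ : ℝ) = 0 := fun γ => by
    simp [kineticAction, visits, Config.count]
  refine ⟨⟨_, by simpa using (isPath_affine (le_refl s) x 0).1, (h _).symm⟩, ?_⟩
  rintro _ ⟨γ, -, rfl⟩
  exact (h γ).ge

theorem optimalAction_eq_sub_maxGain {ω : Config}
    (h : ∀ s t x y : ℝ, s < t → IsLeast (pathActions ω s t x y) (optimalAction ω s t x y))
    {t : ℝ} (ht : 0 ≤ t) (v : ℝ) : optimalAction ω 0 t 0 (v * t) =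
      v ^ 2 / 2 * t - (maxGain 0 t (Config.map (shear v) ω)).toReal := by
  have h1 : IsLeast (pathActions ω 0 t 0 (v * t)) (optimalAction ω 0 t 0 (v * t)) := by
    rcases ht.eq_or_lt with rfl | ht'
    · rw [mul_zero]
      have := isLeast_pathActions_self ω 0 0
      rwa [optimalAction, this.csInf_eq]
    · exact h 0 t 0 _ ht'
  have := eq_neg_toReal_maxGain ht (isLeast_pathActions_map_shear ht h1)
  linarith

/-! ### The gain in a Poisson field and the proof of the theorem. -/

namespace IsPoissonField

variable {P : Measure Config} [IsProbabilityMeasure P]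

theorem ae_maxGain_ne_top (hP : IsPoissonField P) :
    ∀ᵐ ω ∂P, ∀ t, 0 ≤ t → maxGain 0 t ω ≠ ∞ := by
  filter_upwards [ae_all_iff.2 fun n : ℕ => hP.ae_partitionBound_ne_top 0 n] with ω hω t ht
  exact ne_top_of_le_ne_top (exp_maxGain_le_tsum_partitionBound (hω ⌈t⌉₊)).1
    (maxGain_mono ω ht (Nat.le_ceil t))

theorem isSuperadditiveProcess (hP : IsPoissonField P) :
    IsSuperadditiveProcess P fun t ω => (maxGain 0 t ω).toReal where
  measurable t ht := by
    rcases ht.eq_or_lt with rfl | ht'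
    · simp [maxGain_self]
    · exact (measurable_maxGain ht').ennreal_toReal
  nonneg t ω := ENNReal.toReal_nonneg
  zero ω := by simp [maxGain_self]
  mono := by
    filter_upwards [hP.ae_maxGain_ne_top] with ω hω s t hs hst
    exact ENNReal.toReal_mono (hω t (hs.trans hst)) (maxGain_mono ω hs hst)
  superadd s t hs ht := by
    have hZ : ∀ u, 0 < u → Measurable fun ω => (maxGain 0 u ω).toReal :=
      fun u hu => (measurable_maxGain hu).ennreal_toReal
    have hmp := hP.measurePreserving_map (measurePreserving_timeShift s)
    have hm := (hZ t ht).comp hmp.measurable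
    refine ⟨_, ⟨hm.aemeasurable, (hZ t ht).aemeasurable, ?_⟩, ?_, ?_⟩
    · rw [← Measure.map_map (hZ t ht) hmp.measurable, hmp.map_eq]
    · have hR : MeasurableSet {p : ℝ × ℝ | p.2 < s} :=
        measurableSet_lt measurable_snd measurable_const
      -- The gain on `[0, s)` sees only points before time `s`, and the shifted gain only points
      -- from time `s` on.
      have hind := (hP.indepFun_restrict hR).comp (hZ s hs) hm
      convert hind using 1
      · ext ω
        simp only [Function.comp_apply]
        rw [maxGain_congr]
        intro p hp
        exact ⟨fun h => ⟨h, hp.2⟩, fun h => h.1⟩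
      · ext ω
        simp only [Function.comp_apply]
        rw [maxGain_congr]
        intro p hp
        obtain ⟨q, rfl⟩ := (timeShift s).surjective p
        rw [Config.mem_points_map, Config.mem_points_map]
        rw [timeShift_apply] at hp
        have hq : 0 ≤ q.2 - s := hp.1
        exact ⟨fun h => ⟨h, fun hlt : q.2 < s => by linarith⟩, fun h => h.1⟩
    · filter_upwards [hP.ae_maxGain_ne_top] with ω hω
      have hle : maxGain 0 s ω + maxGain 0 t (Config.map (timeShift s) ω) ≤
          maxGain 0 (s + t) ω :=
        (add_le_add le_rfl (maxGain_map_timeShift_le ω s ht.le)).trans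
          (maxGain_add_le ω hs.le (by linarith))
      have hfin := hω (s + t) (by linarith)
      have hne := ENNReal.add_ne_top.1 (ne_top_of_le_ne_top hfin hle)
      simp only [Function.comp_apply]
      rw [← ENNReal.toReal_add hne.1 hne.2]
      exact ENNReal.toReal_mono hfin hle
  exp_bound := by
    refine ⟨max (Real.log growthFactor.toReal) 0, le_max_right _ _, fun n => ?_⟩
    have hg : growthFactor ≤ ENNReal.ofReal (Real.exp (max (Real.log growthFactor.toReal) 0)) := by
      rw [ENNReal.le_ofReal_iff_toReal_le growthFactor_ne_top (Real.exp_nonneg _)]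
      rcases le_or_gt growthFactor.toReal 0 with h0 | h0
      · exact h0.trans (Real.exp_nonneg _)
      · rw [← Real.log_le_iff_le_exp h0]; exact le_max_left _ _
    calc ∫⁻ ω, ENNReal.ofReal (Real.exp (maxGain 0 n ω).toReal) ∂P
        ≤ ∫⁻ ω, ∑' b : ℤ, partitionBound 0 ω n b ∂P := by
          refine lintegral_mono_ae ?_
          filter_upwards [hP.ae_partitionBound_ne_top 0 n] with ω hω
          exact (exp_maxGain_le_tsum_partitionBound hω).2
      _ = growthFactor ^ n := hP.lintegral_tsum_partitionBound 0 n
      _ ≤ _ := by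
          rw [mul_comm, Real.exp_nat_mul, ENNReal.ofReal_pow (Real.exp_nonneg _)]
          gcongr

theorem integral_maxGain_one_pos (hP : IsPoissonField P) :
    0 < ∫ ω, (maxGain 0 1 ω).toReal ∂P := by
  have hZ := hP.isSuperadditiveProcess
  have hnn : 0 ≤ ∫ ω, (maxGain 0 1 ω).toReal ∂P := integral_nonneg fun _ => ENNReal.toReal_nonneg
  refine lt_of_le_of_ne hnn fun h0 => ?_
  rw [eq_comm, integral_eq_zero_iff_of_nonneg (fun _ => ENNReal.toReal_nonneg)
    (hZ.integrable zero_le_one)] at h0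
  -- A single point of `B` can be collected at cost at most `1/4`, a gain of at least `3/4`. A
  -- vanishing mean would force `B` to be empty almost surely, but that has probability `exp (-1/4)
  -- < 1`.
  set B : Set (ℝ × ℝ) := Set.Icc (-(1 / 4)) (1 / 4) ×ˢ Set.Icc (1 / 4) (3 / 4) with hBdef
  have hBm : MeasurableSet B := measurableSet_Icc.prod measurableSet_Icc
  have hBb : Bornology.IsBounded B := (Metric.isBounded_Icc _ _).prod (Metric.isBounded_Icc _ _)
  have hB0 : ∀ᵐ ω ∂P, ω.count B = 0 := by
    filter_upwards [h0, hP.ae_maxGain_ne_top] with ω h1 h2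
    by_contra hne
    obtain ⟨p, hp, hpB⟩ := Set.nonempty_of_ncard_ne_zero hne
    have hto : TimeOrdered (0, 1) (0, 0) [p] := by
      refine ⟨?_, ?_⟩
      · simp only; linarith [hpB.2.1]
      · change p.2 < 1; linarith [hpB.2.2]
    have hE : chainEnergy (0, 1) (0, 0) [p] ≤ 1 / 4 := by
      have hx : p.1 ^ 2 ≤ 1 / 16 := by nlinarith [hpB.1.1, hpB.1.2]
      have hr := hpB.2
      simp only [chainEnergy, segmentCost]
      have e1 : (p.1 - 0) ^ 2 / (2 * (p.2 - 0)) ≤ 1 / 8 := by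
        rw [div_le_iff₀ (by linarith [hr.1])]; linarith [hr.1]
      have e2 : (0 - p.1) ^ 2 / (2 * (1 - p.2)) ≤ 1 / 8 := by
        rw [div_le_iff₀ (by linarith [hr.2])]; linarith [hr.2]
      linarith
    have hge : ENNReal.ofReal (3 / 4) ≤ maxGain 0 1 ω := by
      rw [maxGain_eq_iSup_chainGain zero_lt_one]
      refine le_iSup₂_of_le [p] (by simpa using hp) ?_
      rw [chainGain, if_pos hto]
      refine ENNReal.ofReal_le_ofReal ?_
      have : (0 : ℝ) ≤ ω.indicatorAt (0, 0) := Nat.cast_nonneg _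
      push_cast [List.length_singleton]
      linarith
    have h3 := ENNReal.toReal_mono (h2 1 zero_le_one) hge
    rw [ENNReal.toReal_ofReal (by norm_num)] at h3
    have h4 : (maxGain 0 1 ω).toReal = 0 := h1
    linarith
  have h1 : P.map (fun ω => ω.count B) {0} = 1 := by
    rw [Measure.map_apply (Config.measurable_count hBm hBb) (.of_discrete)]
    exact (mem_ae_iff_prob_eq_one (Config.measurable_count hBm hBb .of_discrete)).1 hB0
  have hvol : volume B = ENNReal.ofReal (1 / 4) := by
    rw [hBdef, Measure.volume_eq_prod, Measure.prod_prod, Real.volume_Icc, Real.volume_Icc,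
      ← ENNReal.ofReal_mul (by norm_num)]
    norm_num
  rw [hP.law_count B hBm hBb, poissonMeasure_singleton, hvol] at h1
  have hr : (((ENNReal.ofReal (1 / 4)).toNNReal : ℝ≥0) : ℝ) = 1 / 4 :=
    ENNReal.toReal_ofReal (by norm_num)
  rw [hr, ENNReal.ofReal_eq_one] at h1
  simp at h1

end IsPoissonField

theorem mainTheorem5 (P : Measure Config) [IsProbabilityMeasure P] (hP : IsPoissonField P) :
    (∀ᵐ ω ∂P, ∀ s t x y : ℝ, s < t →
      IsLeast (pathActions ω s t x y) (optimalAction ω s t x y)) ∧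
    (∀ v : ℝ, ∃ C : ℝ, 0 < C ∧ ∀ t : ℝ, 0 ≤ t →
      Integrable (fun ω => optimalAction ω 0 t 0 (v * t)) P ∧
      ∫ ω, |optimalAction ω 0 t 0 (v * t)| ∂P ≤ C * t) ∧
    ∃ α : ℝ → ℝ,
      (∀ v : ℝ, ∀ᵐ ω ∂P,
        Tendsto (fun t : ℝ => optimalAction ω 0 t 0 (v * t) / t) atTop (𝓝 (α v))) ∧
      (∀ v : ℝ,
        Tendsto (fun t : ℝ => ∫ ω, |optimalAction ω 0 t 0 (v * t) / t - α v| ∂P)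
          atTop (𝓝 0)) ∧
      (∀ v : ℝ, α v = α 0 + v ^ 2 / 2) ∧
      α 0 < 0 := by
  have hleast := hP.ae_isLeast_optimalAction
  have hZ := hP.isSuperadditiveProcess
  obtain ⟨z, hz0, hzle, hz⟩ := hZ.exists_limit
  have hzpos : 0 < z := by
    have := hzle 1 zero_le_one
    have := hP.integral_maxGain_one_pos
    linarith
  have hmp : ∀ v, MeasurePreserving (Config.map (shear v)) P P := fun v =>
    hP.measurePreserving_map (measurePreserving_shear v)
  have heq : ∀ v t, 0 ≤ t → (fun ω => optimalAction ω 0 t 0 (v * t)) =ᵐ[P]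
      fun ω => v ^ 2 / 2 * t - (maxGain 0 t (Config.map (shear v) ω)).toReal := by
    intro v t ht
    filter_upwards [hleast] with ω hω using optimalAction_eq_sub_maxGain hω ht v
  have hint : ∀ v t, 0 ≤ t →
      Integrable (fun ω => (maxGain 0 t (Config.map (shear v) ω)).toReal) P := fun v t ht =>
    (hmp v).integrable_comp_of_integrable (hZ.integrable ht)
  have hcomp : ∀ v (f : Config → ℝ), Measurable f →
      ∫ ω, f (Config.map (shear v) ω) ∂P = ∫ ω, f ω ∂P := by
    intro v f hf
    have := integral_map (μ := P) (hmp v).measurable.aemeasurable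
      hf.aestronglyMeasurable
    rw [(hmp v).map_eq] at this
    exact this.symm
  refine ⟨hleast, fun v => ⟨v ^ 2 / 2 + z, by positivity, fun t ht => ⟨?_, ?_⟩⟩,
    fun v => v ^ 2 / 2 - z, fun v => ?_, fun v => ?_, fun v => by ring, by norm_num [hzpos]⟩
  · exact ((integrable_const _).sub (hint v t ht)).congr (heq v t ht).symm
  · have h1 : ∫ ω, |optimalAction ω 0 t 0 (v * t)| ∂P ≤
        ∫ ω, (v ^ 2 / 2 * t + (maxGain 0 t (Config.map (shear v) ω)).toReal) ∂P := by
      refine integral_mono_ae (((integrable_const _).sub (hint v t ht)).congr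
        (heq v t ht).symm).abs ((integrable_const _).add (hint v t ht)) ?_
      filter_upwards [heq v t ht] with ω hω
      rw [hω]
      have hn : 0 ≤ (maxGain 0 t (Config.map (shear v) ω)).toReal := ENNReal.toReal_nonneg
      have hv : 0 ≤ v ^ 2 / 2 * t := by positivity
      rw [abs_le]
      constructor <;> linarith
    rw [integral_add (integrable_const _) (hint v t ht), hcomp v _ (hZ.measurable t ht)] at h1
    simp only [integral_const, probReal_univ, smul_eq_mul, one_mul] at h1
    linarith [hzle t ht]
  -- The almost sure limit of `Z_t / t` is pulled back along the measure-preserving shear.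
  · filter_upwards [hleast, (hmp v).quasiMeasurePreserving.ae (hZ.ae_tendsto hz)] with ω h1 h2
    refine (h2.const_sub (v ^ 2 / 2)).congr' ?_
    filter_upwards [eventually_gt_atTop (0 : ℝ)] with t ht
    rw [optimalAction_eq_sub_maxGain h1 ht.le v, sub_div, mul_div_cancel_right₀ _ ht.ne']
  · refine (hZ.tendsto_integral_abs hz0 hz).congr' ?_
    filter_upwards [eventually_gt_atTop (0 : ℝ)] with t ht
    rw [← hcomp v (fun ω => |(maxGain 0 t ω).toReal / t - z|)
      (((hZ.measurable t ht.le).div_const t).sub_const z).abs]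
    refine integral_congr_ae ?_
    filter_upwards [heq v t ht.le] with ω hω
    rw [hω, sub_div, mul_div_cancel_right₀ _ ht.ne', ← abs_neg]
    congr 1
    ring
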